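/- Let $d\ge 1$ and let $\{T^z\}_{z\in\mathbb Z^d}$ be a free ergodic measure-preserving action of $\mathbb Z^d$ on a standard Borel probability space $(X,\mu)$. For $f\in L_1(X,\mu)$ and $N\ge 1$ put $$Q_N=\{z\in\mathbb Z^d: 1\le z_1,\dots,z_d\le N\},\qquad P_Nf(x)=N^{-d}\sum_{z\in Q_N} f(T^zx),\qquad F_N=\frac{P_Nf}{\|P_Nf\|_1}.$$ The distribution of the values of a measurable function $g$ on $X$ is the image measure $g_*\mu$. Let $(\nu_k)_{k\ge0}$ be any sequence of Borel probability measures on $\mathbb R$ (for example a constant sequence $\nu_k=\nu$), and let $\rho:\mathbb N\times\mathbb N\to\mathbb R$ be any function. Then there are $f\in L_1(X,\mu)$ with $\int_X f\,d\mu=0$, positive integers $N_k\le R_k<N_{k+1}$ $(k\ge0)$ and scales $a_k>0$, where $a_k=1$ whenever $\int t\,d\nu_k(t)=0$ and $\int|t|\,d\nu_k(t)=1$, such that: 1. $R_k/N_k\ge\rho(k,N_k)$ for all $k$, and $R_k/N_k\to\infty$, $N_{k+1}/R_k\to\infty$ as $k\to\infty$. 2. $\|P_nf\|_1>0$ for all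 $k$ and all $n\in[N_k,R_k]$, and $\max_{n,m\in[N_k,R_k]}\|a_kF_n-a_kF_m\|_1\to0$ as $k\to\infty$. 3. (Values.) For every $g\in C_0(\mathbb R)$, $$\max_{n\in[N_k,R_k]}\Big|\int_X g(a_kF_n)\,d\mu-\int_{\mathbb R} g\,d\nu_k\Big|\to0\qquad(k\to\infty).$$ In particular, if $\nu$ has mean zero and $\int|t|\,d\nu=1$ and $\nu_k=\nu$ for all $k$, then the distributions of the values of $P_{N_k}f/\|P_{N_k}f\|_1$ converge weak-$*$ to $\nu$. 4. (Asymptotic independence.) For every $g\in C_0(\mathbb R^2)$ and every $\varepsilon>0$ there is $K$ such that for all $k\ne j$ with $\max(k,j)\ge K$, all $n\in[N_k,R_k]$ and all $m\in[N_j,R_j]$, $$\Big|\int_X g(a_kF_n,a_jF_m)\,d\mu-\int_X\!\int_X g\big(a_kF_n(x),a_jF_m(y)\big)\,d\mu(x)\,d\mu(y)\Big|<\varepsilon .$$ -/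

import Mathlib

open MeasureTheory Filter Topology
open scoped ZeroAtInfty

/-- The cube `Q_N = {z = (z₁, …, z_d) : 1 ≤ z₁, …, z_d ≤ N}` in `ℤ^d`. -/
noncomputable def cubeQ (d N : ℕ) : Finset (Fin d → ℤ) :=
  Fintype.piFinset fun _ => Finset.Icc 1 (N : ℤ)

/-- The ergodic average `P_N f(x) = N^{-d} ∑_{z ∈ Q_N} f(T^z x)`, where `T^z x = z +ᵥ x`. -/
noncomputable def ergAvg (d : ℕ) {X : Type*} [AddAction (Fin d → ℤ) X]
    (N : ℕ) (f : X → ℝ) (x : X) : ℝ :=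
  ((N : ℝ) ^ d)⁻¹ * ∑ z ∈ cubeQ d N, f (z +ᵥ x)

/-- The norm `‖g‖₁ = ∫ |g| dμ` of an integrable function. -/
noncomputable def normOne {X : Type*} [MeasurableSpace X] (μ : Measure X) (g : X → ℝ) : ℝ :=
  ∫ x, |g x| ∂μ

/-- The normalized average `P_N f / ‖P_N f‖₁`. -/
noncomputable def normalizedAvg (d : ℕ) {X : Type*} [MeasurableSpace X]
    [AddAction (Fin d → ℤ) X] (μ : Measure X) (N : ℕ) (f : X → ℝ) (x : X) : ℝ :=
  ergAvg d N f x / normOne μ (ergAvg d N f)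

/-- The distribution of the values of `g`: the image of `μ` under `x ↦ (x, g x)`, projected
to the space of values. -/
noncomputable def valueDistribution {X Y : Type*} [MeasurableSpace X] [MeasurableSpace Y]
    (μ : Measure X) (g : X → Y) : Measure Y :=
  (μ.map fun x => (x, g x)).map Prod.snd

/-- The distribution `ν` on the line has mean zero and `∫ |t| dν = 1`
(the latter forces `t` to be `ν`-integrable). -/
def IsNormalizedDistribution (ν : Measure ℝ) : Prop :=
  ∫ t, t ∂ν = 0 ∧ ∫ t, |t| ∂ν = 1

/-! The function is a series `f = ∑ c k * h k` with rapidly decreasing coefficients. Each `h k` has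
mean zero, finitely many values and a distribution close to `ν k`, and is almost invariant under all
translations in `Q_{R k}`. For `n ∈ [N k, R k]` the series splits into three parts. The sum `u k` of
the earlier terms is a bounded function of mean zero, averaged out because `N k` is chosen after `u
k` (`tendsto_normOne_ergAvg`). The term `c k * h k` is almost unchanged by averaging. The later
terms are uniformly small compared with `c k`. Hence `P_n f` is close in `L¹` to `c k * h k`, and `a
k * F_n` to `h k` (`normOne_normalized_sub_le`), where `a k` is the first absolute moment of a
finite approximation to `ν k`. This gives the claims about values and about constancy on each
interval.

For independence, `N k` is also so large that the finitely many level sets of `P_m (u k)`, `m ≤ R (k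
- 1)`, have almost constant averages over `Q_{N k}`. Averaging over this cube hardly moves `h k` but
turns the indicators of the level sets into constants, so `h k` is almost uncorrelated with them
(`abs_integral_mul_sub_le`, `abs_integral_pair_sub_le`). At an earlier scale `P_m f` is uniformly
close to `P_m (u k)`, so the independence passes to `f`.

To build `h k`, freeness gives a set with disjoint translates by `Q_{2n}` that fill a fixed
proportion of the space; the union of its translates by `Q_n` is almost invariant and of measure
bounded away from `0` and `1` (`exists_almost_invariant_set`). Cutting repeatedly by such sets, each
almost independent of the partition so far, yields almost invariant partitions into arbitrarily
small pieces. Grouping the pieces realizes any finite distribution up to a small error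
(`exists_almost_invariant_labelling`), and `exists_discreteApprox` supplies the finite
distributions. -/

/-! ### Cubes in `ℤ^d` and their Følner property. -/

theorem mem_cubeQ {d n : ℕ} {z : Fin d → ℤ} : z ∈ cubeQ d n ↔ ∀ i, 1 ≤ z i ∧ z i ≤ n := by
  simp [cubeQ]

theorem card_cubeQ (d n : ℕ) : (cubeQ d n).card = n ^ d := by
  simp [cubeQ]

theorem cubeQ_mono {d m n : ℕ} (h : m ≤ n) : cubeQ d m ⊆ cubeQ d n := by
  intro z hz
  rw [mem_cubeQ] at *
  intro i
  have := hz i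
  omega

/-- Cubes are Følner sets. -/
theorem tendsto_card_cubeQ_boundary {d : ℕ} (w : Fin d → ℤ) :
    Tendsto (fun n : ℕ => (((cubeQ d n).filter fun z => z + w ∉ cubeQ d n).card : ℝ) / (n : ℝ) ^ d)
      atTop (𝓝 0) := by
  -- The inner box: translation by `w` keeps its points in the cube, and its share of the cube tends
  -- to `1`.
  set I : ℕ → Finset (Fin d → ℤ) := fun n =>
    Fintype.piFinset fun i => Finset.Icc (1 + |w i|) ((n : ℤ) - |w i|) with hI
  have hIQ : ∀ n, I n ⊆ cubeQ d n := by
    intro n z hz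
    rw [mem_cubeQ]
    simp only [hI, Fintype.mem_piFinset, Finset.mem_Icc] at hz
    intro i
    have := hz i
    have := abs_nonneg (w i)
    omega
  have hsub : ∀ n, ((cubeQ d n).filter fun z => z + w ∉ cubeQ d n) ⊆ cubeQ d n \ I n := by
    intro n z hz
    rw [Finset.mem_filter] at hz
    rw [Finset.mem_sdiff]
    refine ⟨hz.1, fun h => hz.2 ?_⟩
    rw [mem_cubeQ]
    simp only [hI, Fintype.mem_piFinset, Finset.mem_Icc] at h
    intro i
    have := h i
    have := neg_abs_le (w i)
    have := le_abs_self (w i)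
    simp only [Pi.add_apply]
    omega
  have hcardI : ∀ n, ((I n).card : ℝ) = ∏ i, (((n : ℤ) - 2 * |w i|).toNat : ℝ) := by
    intro n
    simp only [hI, Fintype.card_piFinset, Int.card_Icc, Nat.cast_prod]
    congr! 3
    ring
  have h1 : Tendsto (fun n : ℕ => ((I n).card : ℝ) / (n : ℝ) ^ d) atTop (𝓝 1) := by
    have : ∀ i ∈ (Finset.univ : Finset (Fin d)),
        Tendsto (fun n : ℕ => ((((n : ℤ) - 2 * |w i|).toNat : ℕ) : ℝ) / (n : ℝ)) atTop (𝓝 1) := by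
      intro i _
      have h0 : Tendsto (fun n : ℕ => 1 - (2 * |(w i : ℝ)|) / (n : ℝ)) atTop (𝓝 (1 - 0)) :=
        tendsto_const_nhds.sub (tendsto_const_div_atTop_nhds_zero_nat _)
      rw [sub_zero] at h0
      refine h0.congr' ?_
      filter_upwards [eventually_ge_atTop ((2 * |w i|).toNat + 1)] with n hn
      have hn0 : (n : ℝ) ≠ 0 := by
          have : 0 < n := by omega
          positivity
      have hz : ((((n : ℤ) - 2 * |w i|).toNat : ℕ) : ℤ) = (n : ℤ) - 2 * |w i| := by omega
      have hz' : ((((n : ℤ) - 2 * |w i|).toNat : ℕ) : ℝ) = (n : ℝ) - 2 * |(w i : ℝ)| := by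
        exact_mod_cast hz
      rw [hz']
      field_simp
    have h2 := tendsto_finsetProd _ this
    simp only [Finset.prod_const_one] at h2
    refine h2.congr fun n => ?_
    rw [hcardI, Finset.prod_div_distrib]
    simp
  have h3 : Tendsto (fun n : ℕ => 1 - ((I n).card : ℝ) / (n : ℝ) ^ d) atTop (𝓝 0) := by
    simpa using (tendsto_const_nhds (x := (1 : ℝ))).sub h1
  refine tendsto_of_tendsto_of_tendsto_of_le_of_le' tendsto_const_nhds h3 ?_ ?_
  · exact Eventually.of_forall fun n => by positivity
  · filter_upwards [eventually_ge_atTop 1] with n hn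
    have hn0 : (0 : ℝ) < (n : ℝ) ^ d := by positivity
    rw [div_le_iff₀ hn0, sub_mul, div_mul_cancel₀ _ hn0.ne', one_mul]
    have h5 := Finset.card_le_card (hsub n)
    have h6 := Finset.card_sdiff_add_card_eq_card (hIQ n)
    rw [card_cubeQ] at h6
    have h7 : (((cubeQ d n).filter fun z => z + w ∉ cubeQ d n).card : ℝ) + (I n).card
        ≤ (n : ℝ) ^ d := by exact_mod_cast (by omega)
    linarith

/-! ### The mean ergodic theorem in Hilbert space. -/

section Hilbert

variable {d : ℕ} {H : Type*} [NormedAddCommGroup H] [InnerProductSpace ℝ H]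

/-- The mean of the operators `U z` over the cube `Q_n`. -/
noncomputable def opAvg (U : (Fin d → ℤ) → H →L[ℝ] H) (n : ℕ) : H →L[ℝ] H :=
  ((n : ℝ) ^ d)⁻¹ • ∑ z ∈ cubeQ d n, U z

theorem opAvg_apply (U : (Fin d → ℤ) → H →L[ℝ] H) (n : ℕ) (v : H) :
    opAvg U n v = ((n : ℝ) ^ d)⁻¹ • ∑ z ∈ cubeQ d n, U z v := by
  simp [opAvg]

theorem norm_opAvg_apply_le {U : (Fin d → ℤ) → H →L[ℝ] H} (hU : ∀ z v, ‖U z v‖ = ‖v‖)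
    {n : ℕ} (v : H) : ‖opAvg U n v‖ ≤ ‖v‖ := by
  rw [opAvg_apply, norm_smul]
  have h1 : ‖∑ z ∈ cubeQ d n, U z v‖ ≤ (n : ℝ) ^ d * ‖v‖ := by
    refine (norm_sum_le _ _).trans ?_
    simp [hU, card_cubeQ]
  rw [norm_inv, norm_pow, Real.norm_natCast]
  -- The empty cube (`n = 0`, `d ≥ 1`) is harmless: its average is `0` because `0⁻¹ = 0`.
  rcases eq_or_ne ((n : ℝ) ^ d) 0 with h0 | h0
  · simp [h0]
  · have : (0 : ℝ) < (n : ℝ) ^ d := lt_of_le_of_ne (by positivity) h0.symm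
    rw [inv_mul_le_iff₀ this]
    exact h1

/-- The sum over the cube telescopes to a sum over the symmetric difference of the cube and its
translate by `w`, which is negligible by the Følner property. -/
theorem tendsto_opAvg_coboundary {U : (Fin d → ℤ) → H →L[ℝ] H} (hU : ∀ z v, ‖U z v‖ = ‖v‖)
    (hadd : ∀ z w v, U (z + w) v = U z (U w v)) (w : Fin d → ℤ) (g : H) :
    Tendsto (fun n => opAvg U n (U w g - g)) atTop (𝓝 0) := by
  have hb := (tendsto_card_cubeQ_boundary w).mul_const (2 * ‖g‖)
  rw [zero_mul] at hb
  refine squeeze_zero_norm (fun n => ?_) hb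
  rw [opAvg_apply, norm_smul, norm_inv, norm_pow, Real.norm_natCast, div_eq_inv_mul, mul_assoc]
  refine mul_le_mul_of_nonneg_left ?_ (by positivity)
  have hinj : Set.InjOn (fun z : Fin d → ℤ => z + w) (cubeQ d n) :=
    fun a _ b _ h => add_right_cancel h
  have h1 : ∑ z ∈ cubeQ d n, U z (U w g - g) =
      ∑ z ∈ (cubeQ d n).image (fun z => z + w), U z g - ∑ z ∈ cubeQ d n, U z g := by
    rw [Finset.sum_image hinj, ← Finset.sum_sub_distrib]
    exact Finset.sum_congr rfl fun z _ => by rw [map_sub, hadd]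
  have hc : ((cubeQ d n).image (fun z => z + w) \ cubeQ d n).card
      ≤ ((cubeQ d n).filter fun z => z + w ∉ cubeQ d n).card := by
    refine le_trans (Finset.card_le_card ?_) (Finset.card_image_le (f := fun z => z + w))
    intro y hy
    simp only [Finset.mem_sdiff, Finset.mem_image, Finset.mem_filter] at hy ⊢
    obtain ⟨⟨z, hz, rfl⟩, h⟩ := hy
    exact ⟨z, ⟨hz, h⟩, rfl⟩
  have hc' : (cubeQ d n \ (cubeQ d n).image (fun z => z + w)).card
      = ((cubeQ d n).image (fun z => z + w) \ cubeQ d n).card :=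
    Finset.card_sdiff_comm (Finset.card_image_of_injOn hinj).symm
  have hs : ∀ s : Finset (Fin d → ℤ), ‖∑ z ∈ s, U z g‖ ≤ s.card * ‖g‖ := fun s => by
    refine (norm_sum_le _ _).trans ?_
    simp [hU]
  rw [h1, ← Finset.sum_sdiff_sub_sum_sdiff]
  refine (norm_sub_le _ _).trans ((add_le_add (hs _) (hs _)).trans ?_)
  rw [hc']
  have : (((cubeQ d n).image (fun z => z + w) \ cubeQ d n).card : ℝ)
      ≤ ((cubeQ d n).filter fun z => z + w ∉ cubeQ d n).card := by exact_mod_cast hc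
  nlinarith [norm_nonneg g]

/-- Von Neumann's mean ergodic theorem for isometric actions of `ℤ^d`. -/
theorem exists_tendsto_opAvg [CompleteSpace H] {U : (Fin d → ℤ) → H →L[ℝ] H}
    (hU : ∀ z v, ‖U z v‖ = ‖v‖)
    (hadd : ∀ z w v, U (z + w) v = U z (U w v)) (v : H) :
    ∃ m : H, (∀ z, U z m = m) ∧ Tendsto (fun n => opAvg U n v) atTop (𝓝 m) := by
  set S : Submodule ℝ H := Submodule.span ℝ {x | ∃ w g, x = U w g - g} with hS
  have hS0 : ∀ x ∈ S, Tendsto (fun n => opAvg U n x) atTop (𝓝 0) := by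
    intro x hx
    induction hx using Submodule.span_induction with
    | mem x hx =>
      obtain ⟨w, g, rfl⟩ := hx
      exact tendsto_opAvg_coboundary hU hadd w g
    | zero => simp
    | add x y _ _ h1 h2 => simpa using h1.add h2
    | smul c x _ h => simpa using h.const_smul c
  have hcl : ∀ x ∈ S.topologicalClosure, Tendsto (fun n => opAvg U n x) atTop (𝓝 0) := by
    intro x hx
    rw [Metric.tendsto_atTop]
    intro ε hε
    have hx' : x ∈ closure (S : Set H) := hx
    obtain ⟨y, hy, hxy⟩ := Metric.mem_closure_iff.1 hx' (ε / 2) (by positivity)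
    obtain ⟨M, hM⟩ := Metric.tendsto_atTop.1 (hS0 y hy) (ε / 2) (by positivity)
    refine ⟨M, fun n hn => ?_⟩
    have h1 := hM n hn
    rw [dist_zero_right] at h1 ⊢
    have h2 : opAvg U n x = opAvg U n (x - y) + opAvg U n y := by simp
    rw [h2]
    have h3 := norm_opAvg_apply_le hU (n := n) (x - y)
    rw [dist_eq_norm] at hxy
    exact (norm_add_le _ _).trans_lt (by linarith)
  set K := S.topologicalClosure with hK
  have : CompleteSpace K := S.isClosed_topologicalClosure.completeSpace_coe
  obtain ⟨p, hp, m, hm, hv⟩ := K.exists_add_mem_mem_orthogonal v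
  -- A vector orthogonal to all coboundaries is fixed: `⟪U z m, m⟫ = ‖m‖²` and `‖U z m‖ = ‖m‖` force
  -- `‖U z m - m‖ = 0`.
  have hinv : ∀ z, U z m = m := by
    intro z
    have h1 : U z m - m ∈ K := S.le_topologicalClosure (Submodule.subset_span ⟨z, m, rfl⟩)
    have h2 : inner ℝ (U z m - m) m = 0 := (Submodule.mem_orthogonal K m).1 hm _ h1
    rw [inner_sub_left, real_inner_self_eq_norm_sq] at h2
    have h3 := norm_sub_sq_real (U z m) m
    rw [hU] at h3
    have h4 : ‖U z m - m‖ = 0 := by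
      have : ‖U z m - m‖ ^ 2 = 0 := by linarith
      simpa using this
    exact sub_eq_zero.1 (norm_eq_zero.1 h4)
  refine ⟨m, hinv, ?_⟩
  have hm' : ∀ᶠ n : ℕ in atTop, opAvg U n m = m := by
    filter_upwards [eventually_ge_atTop 1] with n hn
    rw [opAvg_apply]
    simp only [hinv, Finset.sum_const, card_cubeQ]
    rw [← Nat.cast_smul_eq_nsmul ℝ, smul_smul]
    push_cast
    rw [inv_mul_cancel₀ (by positivity), one_smul]
  have h5 : Tendsto (fun n => opAvg U n p + opAvg U n m) atTop (𝓝 (0 + m)) :=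
    (hcl p hp).add (tendsto_const_nhds.congr' (hm'.mono fun n h => h.symm))
  rw [zero_add] at h5
  refine h5.congr fun n => ?_
  rw [← map_add, ← hv]

end Hilbert

/-! ### Elementary properties of averages and of the `L¹` norm. -/

section AvgAlgebra

variable {d : ℕ} {X : Type*} [AddAction (Fin d → ℤ) X]

theorem ergAvg_add (n : ℕ) (f g : X → ℝ) :
    ergAvg d n (fun x => f x + g x) = fun x => ergAvg d n f x + ergAvg d n g x := by
  funext x
  simp [ergAvg, Finset.sum_add_distrib, mul_add]

theorem ergAvg_smul (n : ℕ) (c : ℝ) (f : X → ℝ) :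
    ergAvg d n (fun x => c * f x) = fun x => c * ergAvg d n f x := by
  funext x
  simp only [ergAvg, ← Finset.mul_sum]
  ring

theorem ergAvg_sub (n : ℕ) (f g : X → ℝ) :
    ergAvg d n (fun x => f x - g x) = fun x => ergAvg d n f x - ergAvg d n g x := by
  funext x
  simp [ergAvg, Finset.sum_sub_distrib, mul_sub]

theorem abs_ergAvg_le {f : X → ℝ} {C : ℝ} (hC : ∀ x, |f x| ≤ C) (n : ℕ) (x : X) :
    |ergAvg d n f x| ≤ C := by
  have hC0 : 0 ≤ C := (abs_nonneg _).trans (hC x)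
  unfold ergAvg
  rw [abs_mul, abs_of_nonneg (a := ((n : ℝ) ^ d)⁻¹) (by positivity)]
  have h1 : |∑ z ∈ cubeQ d n, f (z +ᵥ x)| ≤ (n : ℝ) ^ d * C := by
    refine (Finset.abs_sum_le_sum_abs _ _).trans ?_
    refine (Finset.sum_le_sum fun z _ => hC (z +ᵥ x)).trans ?_
    simp [card_cubeQ]
  rcases eq_or_ne ((n : ℝ) ^ d) 0 with h0 | h0
  · simp [h0, hC0]
  · have : (0 : ℝ) < (n : ℝ) ^ d := lt_of_le_of_ne (by positivity) h0.symm
    rw [inv_mul_le_iff₀ this]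
    exact h1

end AvgAlgebra

theorem measureReal_preimage_vadd {d : ℕ} {X : Type*} [MeasurableSpace X] {μ : Measure X}
    [AddAction (Fin d → ℤ) X] [VAddInvariantMeasure (Fin d → ℤ) X μ] {s : Set X} (z : Fin d → ℤ) :
    μ.real {x | z +ᵥ x ∈ s} = μ.real s := by
  unfold Measure.real
  rw [← measure_preimage_vadd μ z s]
  rfl

section Avg

variable {d : ℕ} {X : Type*} [MeasurableSpace X] {μ : Measure X}

theorem integrable_of_abs_le [IsFiniteMeasure μ] {f : X → ℝ} (hf : Measurable f) {C : ℝ}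
    (hC : ∀ x, |f x| ≤ C) : Integrable f μ :=
  Integrable.of_bound hf.aestronglyMeasurable C (Eventually.of_forall hC)

theorem normOne_nonneg (f : X → ℝ) : 0 ≤ normOne μ f :=
  integral_nonneg fun _ => abs_nonneg _

theorem normOne_le_of_abs_le [IsProbabilityMeasure μ] {f : X → ℝ} {C : ℝ}
    (hC : ∀ x, |f x| ≤ C) : normOne μ f ≤ C := by
  have := norm_integral_le_of_norm_le_const (μ := μ) (f := fun x => |f x|) (C := C)
    (Eventually.of_forall fun x => by simpa using hC x)
  simp only [probReal_univ, mul_one] at this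
  exact (le_abs_self _).trans this

theorem normOne_add_le {f g : X → ℝ} (hf : Integrable f μ) (hg : Integrable g μ) :
    normOne μ (fun x => f x + g x) ≤ normOne μ f + normOne μ g := by
  unfold normOne
  rw [← integral_add hf.abs hg.abs]
  exact integral_mono (hf.add hg).abs (hf.abs.add hg.abs) fun x => abs_add_le _ _

theorem normOne_smul (c : ℝ) (f : X → ℝ) : normOne μ (fun x => c * f x) = |c| * normOne μ f := by
  unfold normOne
  simp_rw [abs_mul]
  rw [integral_const_mul]

theorem normOne_sub_comm (f g : X → ℝ) :
    normOne μ (fun x => f x - g x) = normOne μ (fun x => g x - f x) := by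
  unfold normOne
  simp_rw [abs_sub_comm]

variable [AddAction (Fin d → ℤ) X] [MeasurableConstVAdd (Fin d → ℤ) X]

theorem Measurable.comp_vadd {β : Type*} [MeasurableSpace β] {f : X → β} (hf : Measurable f)
    (z : Fin d → ℤ) : Measurable fun x => f (z +ᵥ x) :=
  hf.comp (measurable_const_vadd z)

theorem measurable_ergAvg {f : X → ℝ} (hf : Measurable f) (n : ℕ) :
    Measurable (ergAvg d n f) := by
  unfold ergAvg
  exact (Finset.measurable_fun_sum _ fun z _ => hf.comp_vadd z).const_mul _

variable [VAddInvariantMeasure (Fin d → ℤ) X μ]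

theorem integral_comp_vadd (z : Fin d → ℤ) (f : X → ℝ) :
    ∫ x, f (z +ᵥ x) ∂μ = ∫ x, f x ∂μ :=
  (measurePreserving_vadd z μ).integral_comp (measurableEmbedding_const_vadd z) f

/-- `‖P_n f - f‖₁` is bounded by the largest displacement of `f` over the cube. -/
theorem normOne_ergAvg_sub_le {f : X → ℝ} (hf : Integrable f μ) {n : ℕ} (hn : 1 ≤ n) {δ : ℝ}
    (h : ∀ z ∈ cubeQ d n, ∫ x, |f (z +ᵥ x) - f x| ∂μ ≤ δ) :
    normOne μ (fun x => ergAvg d n f x - f x) ≤ δ := by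
  have hn0 : (0 : ℝ) < (n : ℝ) ^ d := by positivity
  have hi : ∀ z : Fin d → ℤ, Integrable (fun x => f (z +ᵥ x)) μ := fun z =>
    (measurePreserving_vadd z μ).integrable_comp_of_integrable hf
  have hd : ∀ z : Fin d → ℤ, Integrable (fun x => |f (z +ᵥ x) - f x|) μ := fun z =>
    ((hi z).sub hf).abs
  have e : ∀ x, |ergAvg d n f x - f x| ≤
      ((n : ℝ) ^ d)⁻¹ * ∑ z ∈ cubeQ d n, |f (z +ᵥ x) - f x| := by
    intro x
    have h1 : ergAvg d n f x - f x =
        ((n : ℝ) ^ d)⁻¹ * ∑ z ∈ cubeQ d n, (f (z +ᵥ x) - f x) := by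
      unfold ergAvg
      rw [Finset.sum_sub_distrib, mul_sub]
      simp only [Finset.sum_const, card_cubeQ, nsmul_eq_mul]
      push_cast
      rw [inv_mul_cancel_left₀ hn0.ne']
    rw [h1, abs_mul, abs_of_pos (inv_pos.2 hn0)]
    gcongr
    exact Finset.abs_sum_le_sum_abs _ _
  have hint : Integrable (fun x => ((n : ℝ) ^ d)⁻¹ * ∑ z ∈ cubeQ d n, |f (z +ᵥ x) - f x|) μ :=
    (integrable_finsetSum _ fun z _ => hd z).const_mul _
  have h2 : normOne μ (fun x => ergAvg d n f x - f x) ≤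
      ∫ x, ((n : ℝ) ^ d)⁻¹ * ∑ z ∈ cubeQ d n, |f (z +ᵥ x) - f x| ∂μ :=
    integral_mono_of_nonneg (Eventually.of_forall fun _ => abs_nonneg _) hint
      (Eventually.of_forall e)
  refine h2.trans ?_
  rw [integral_const_mul, integral_finsetSum _ fun z _ => hd z,
    inv_mul_le_iff₀ hn0]
  refine (Finset.sum_le_sum h).trans ?_
  simp [card_cubeQ]

theorem integral_ergAvg {f : X → ℝ} (hf : Integrable f μ) {n : ℕ} (hn : 1 ≤ n) :
    ∫ x, ergAvg d n f x ∂μ = ∫ x, f x ∂μ := by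
  have hn0 : (0 : ℝ) < (n : ℝ) ^ d := by positivity
  have hi : ∀ z : Fin d → ℤ, Integrable (fun x => f (z +ᵥ x)) μ := fun z =>
    (measurePreserving_vadd z μ).integrable_comp_of_integrable hf
  unfold ergAvg
  rw [integral_const_mul, integral_finsetSum _ fun z _ => hi z]
  simp only [integral_comp_vadd, Finset.sum_const, card_cubeQ, nsmul_eq_mul]
  push_cast
  rw [inv_mul_cancel_left₀ hn0.ne']

end Avg

/-- By ergodicity the preimage of every measurable set is null or conull; countably many sets
separate the points of `ℝ`, so only one value survives. -/
theorem ae_eq_const_of_invariant {d : ℕ} {X : Type*} [MeasurableSpace X]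
    {μ : Measure X} [AddAction (Fin d → ℤ) X] [ErgodicVAdd (Fin d → ℤ) X μ] {g : X → ℝ} (hg : AEMeasurable g μ)
    (h : ∀ z : Fin d → ℤ, (fun x => g (z +ᵥ x)) =ᵐ[μ] g) : ∃ c, g =ᵐ[μ] Function.const X c := by
  refine exists_eventuallyEq_const_of_forall_separating MeasurableSet fun U hU => ?_
  have h1 : EventuallyConst (g ⁻¹' U) (ae μ) := by
    refine aeconst_of_forall_preimage_vadd_ae_eq (Fin d → ℤ)
      (hg.nullMeasurableSet_preimage hU) fun z => ?_
    filter_upwards [h z] with x hx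
    change (g (z +ᵥ x) ∈ U) = (g x ∈ U)
    rw [hx]
  rcases eventuallyConst_set'.1 h1 with h2 | h2
  · right
    filter_upwards [h2] with x hx
    intro hxU
    have : x ∈ (∅ : Set X) := hx.mp hxU
    exact this
  · left
    filter_upwards [h2] with x hx
    exact hx.mpr trivial

/-! ### The mean ergodic theorem in `L¹`. -/

section MeanErgodic

variable {d : ℕ} {X : Type*} [MeasurableSpace X] {μ : Measure X} [IsProbabilityMeasure μ]
  [AddAction (Fin d → ℤ) X] [MeasurableConstVAdd (Fin d → ℤ) X] [ErgodicVAdd (Fin d → ℤ) X μ]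

/-- The mean ergodic theorem in `L¹` for bounded functions. -/
theorem tendsto_normOne_ergAvg {f : X → ℝ} (hf : Measurable f) {C : ℝ} (hC : ∀ x, |f x| ≤ C) :
    Tendsto (fun n => normOne μ fun x => ergAvg d n f x - ∫ y, f y ∂μ) atTop (𝓝 0) := by
  have mp : ∀ z : Fin d → ℤ, MeasurePreserving (fun x : X => z +ᵥ x) μ μ := fun z =>
    measurePreserving_vadd z μ
  let U : (Fin d → ℤ) → Lp ℝ 2 μ →L[ℝ] Lp ℝ 2 μ := fun z =>
    (Lp.compMeasurePreservingₗᵢ ℝ (fun x : X => z +ᵥ x) (mp z)).toContinuousLinearMap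
  have hUae : ∀ z v, U z v =ᵐ[μ] fun x => v (z +ᵥ x) := fun z v =>
    Lp.coeFn_compMeasurePreserving v (mp z)
  have hU : ∀ z v, ‖U z v‖ = ‖v‖ := fun z v =>
    (Lp.compMeasurePreservingₗᵢ ℝ (fun x : X => z +ᵥ x) (mp z)).norm_map v
  have hadd : ∀ z w v, U (z + w) v = U z (U w v) := by
    intro z w v
    apply Lp.ext
    have h1 := (mp z).quasiMeasurePreserving.ae_eq_comp (hUae w v)
    filter_upwards [hUae (z + w) v, hUae z (U w v), h1] with x h2 h3 h4
    rw [h2, h3]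
    simp only [Function.comp] at h4
    rw [h4, add_comm, add_vadd]
  have hmem : MemLp f 2 μ := MemLp.of_bound hf.aestronglyMeasurable C (Eventually.of_forall hC)
  obtain ⟨m, hm, hlim⟩ := exists_tendsto_opAvg hU hadd hmem.toLp
  obtain ⟨c, hc⟩ : ∃ c, (m : X → ℝ) =ᵐ[μ] Function.const X c := by
    refine ae_eq_const_of_invariant (d := d) (Lp.aestronglyMeasurable m).aemeasurable fun z => ?_
    have h1 := hUae z m
    rw [hm z] at h1
    exact h1.symm
  have hUf : ∀ z, U z hmem.toLp =ᵐ[μ] fun x => f (z +ᵥ x) := fun z =>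
    (hUae z _).trans ((mp z).quasiMeasurePreserving.ae_eq_comp hmem.coeFn_toLp)
  have havg : ∀ n, opAvg U n hmem.toLp =ᵐ[μ] ergAvg d n f := by
    intro n
    have hall : ∀ᵐ x ∂μ, ∀ z, U z hmem.toLp x = f (z +ᵥ x) := ae_all_iff.2 hUf
    have h1 := Lp.coeFn_smul (((n : ℝ) ^ d)⁻¹) (∑ z ∈ cubeQ d n, U z hmem.toLp)
    have h2 := Lp.coeFn_fun_finsetSum (cubeQ d n) (fun z => U z hmem.toLp)
    rw [opAvg_apply]
    filter_upwards [hall, h1, h2] with x h3 h4 h5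
    rw [h4, Pi.smul_apply, h5, smul_eq_mul]
    simp only [h3]
    rfl
  have hL1 : ∀ n, normOne μ (fun x => ergAvg d n f x - c) ≤ ‖opAvg U n hmem.toLp - m‖ := by
    intro n
    have hfin := (Lp.memLp (opAvg U n hmem.toLp - m)).eLpNorm_ne_top
    rw [Lp.norm_def]
    have h1 : (fun x => ergAvg d n f x - c) =ᵐ[μ] (opAvg U n hmem.toLp - m : Lp ℝ 2 μ) := by
      filter_upwards [Lp.coeFn_sub (opAvg U n hmem.toLp) m, havg n, hc] with x h2 h3 h4
      rw [h2, Pi.sub_apply, h3, h4]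
      rfl
    have h2 : normOne μ (fun x => ergAvg d n f x - c)
        = (eLpNorm (fun x => ergAvg d n f x - c) 1 μ).toReal := by
      rw [eLpNorm_one_eq_lintegral_enorm]
      unfold normOne
      simp_rw [← Real.norm_eq_abs]
      rw [integral_norm_eq_lintegral_enorm]
      exact ((measurable_ergAvg hf n).sub_const c).aestronglyMeasurable
    rw [h2, eLpNorm_congr_ae h1]
    exact ENNReal.toReal_mono hfin
      (eLpNorm_le_eLpNorm_of_exponent_le (by norm_num) (Lp.aestronglyMeasurable _))
  have hlim' : Tendsto (fun n => ‖opAvg U n hmem.toLp - m‖) atTop (𝓝 0) :=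
    tendsto_iff_norm_sub_tendsto_zero.1 hlim
  have ht : Tendsto (fun n => normOne μ fun x => ergAvg d n f x - c) atTop (𝓝 0) :=
    squeeze_zero (fun _ => normOne_nonneg _) hL1 hlim'
  -- Averaging preserves the integral, which identifies the constant limit.
  have hcf : ∫ y, f y ∂μ = c := by
    have h1 : ∀ᶠ n in atTop, |∫ y, f y ∂μ - c| ≤ normOne μ fun x => ergAvg d n f x - c := by
      filter_upwards [eventually_ge_atTop 1] with n hn
      have h2 : Integrable (ergAvg d n f) μ :=
        integrable_of_abs_le (measurable_ergAvg hf n) (abs_ergAvg_le hC n)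
      rw [← integral_ergAvg (d := d) (integrable_of_abs_le hf hC) hn]
      have h3 : ∫ x, ergAvg d n f x ∂μ - c = ∫ x, (ergAvg d n f x - c) ∂μ := by
        rw [integral_sub h2 (integrable_const c)]
        simp
      rw [h3]
      exact abs_integral_le_integral_abs
    have h4 : |∫ y, f y ∂μ - c| ≤ 0 := ge_of_tendsto ht h1
    exact sub_eq_zero.1 (abs_nonpos_iff.1 h4)
  rw [hcf]
  exact ht

end MeanErgodic

/-! ### Separated sets, towers and almost invariant sets for free actions. -/

/-- Greedy construction of a maximal set meeting none of its translates by `F`. -/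
def greedySet {G X : Type*} [VAdd G X] (F : Set G) (B : ℕ → Set X) : ℕ → Set X
  | 0 => ∅
  | i + 1 => greedySet F B i ∪ {x ∈ B i | ∀ z ∈ F, z +ᵥ x ∉ greedySet F B i}

theorem greedySet_mono {G X : Type*} [VAdd G X] (F : Set G) (B : ℕ → Set X) :
    Monotone (greedySet F B) :=
  monotone_nat_of_le_succ fun _ => Set.subset_union_left

theorem vadd_notMem_greedySet {G X : Type*} [AddGroup G] [AddAction G X] {F : Set G}
    (hF : ∀ z ∈ F, -z ∈ F) {B : ℕ → Set X} (hB : ∀ i, ∀ x ∈ B i, ∀ z ∈ F, z +ᵥ x ∉ B i) (i : ℕ) :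
    ∀ x ∈ greedySet F B i, ∀ z ∈ F, z +ᵥ x ∉ greedySet F B i := by
  induction i with
  | zero => intro x hx; exact hx.elim
  | succ i ih =>
    rintro x (hx | hx) z hz (h | h)
    · exact ih x hx z hz h
    · refine h.2 (-z) (hF z hz) ?_
      rwa [neg_vadd_vadd]
    · exact hx.2 z hz h
    · exact hB i x hx.1 z hz h.1

theorem measurableSet_greedySet {G X : Type*} [VAdd G X] [MeasurableSpace X]
    [MeasurableConstVAdd G X] {F : Set G} (hF : F.Countable) {B : ℕ → Set X}
    (hB : ∀ i, MeasurableSet (B i)) (i : ℕ) : MeasurableSet (greedySet F B i) := by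
  induction i with
  | zero => exact MeasurableSet.empty
  | succ i ih =>
    refine ih.union ((hB i).inter ?_)
    have : {x : X | ∀ z ∈ F, z +ᵥ x ∉ greedySet F B i}
        = ⋂ z ∈ F, {x | z +ᵥ x ∈ greedySet F B i}ᶜ := by
      ext x; simp
    change MeasurableSet {x : X | ∀ z ∈ F, z +ᵥ x ∉ greedySet F B i}
    rw [this]
    exact MeasurableSet.biInter hF fun z _ => (measurable_const_vadd z ih).compl

/-- For a free action there is a measurable set which is disjoint from its translates by a finite
symmetric set `F`, and whose translates by `F ∪ {0}` cover the space. -/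
theorem exists_maximal_separated {G X : Type*} [AddGroup G] [AddAction G X] [MeasurableSpace X]
    [StandardBorelSpace X] [MeasurableConstVAdd G X] {μ : Measure X} (F : Finset G)
    (hF : ∀ z ∈ F, -z ∈ F) (hfree : ∀ z ∈ F, ∀ᵐ x ∂μ, z +ᵥ x ≠ x) :
    ∃ A : Set X, MeasurableSet A ∧ (∀ x ∈ A, ∀ z ∈ F, z +ᵥ x ∉ A) ∧
      ∀ᵐ x ∂μ, x ∈ A ∨ ∃ z ∈ F, z +ᵥ x ∈ A := by
  let φ : X → ℝ := embeddingReal X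
  have hφ : MeasurableEmbedding φ := measurableEmbedding_embeddingReal X
  obtain ⟨e, he⟩ := exists_surjective_nat (ℚ × ℚ)
  let I : ℕ → Set ℝ := fun i => Set.Ioo ((e i).1 : ℝ) (e i).2
  let B : ℕ → Set X := fun i => {x | φ x ∈ I i ∧ ∀ z ∈ F, φ (z +ᵥ x) ∉ I i}
  have hBm : ∀ i, MeasurableSet (B i) := by
    intro i
    have : B i = φ ⁻¹' (I i) ∩ ⋂ z ∈ F, ((fun x => φ (z +ᵥ x)) ⁻¹' (I i))ᶜ := by
      ext x; simp [B]
    rw [this]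
    refine (hφ.measurable measurableSet_Ioo).inter (F.measurableSet_biInter fun z _ => ?_)
    exact ((hφ.measurable.comp (measurable_const_vadd z)) measurableSet_Ioo).compl
  have hB : ∀ i, ∀ x ∈ B i, ∀ z ∈ (F : Set G), z +ᵥ x ∉ B i :=
    fun i x hx z hz h => hx.2 z hz h.1
  refine ⟨⋃ i, greedySet (F : Set G) B i, MeasurableSet.iUnion fun i =>
    measurableSet_greedySet F.countable_toSet hBm i, ?_, ?_⟩
  · intro x hx z hz h
    obtain ⟨i, hi⟩ := Set.mem_iUnion.1 hx
    obtain ⟨j, hj⟩ := Set.mem_iUnion.1 h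
    exact vadd_notMem_greedySet (F := (F : Set G)) hF hB (max i j) x
      (greedySet_mono _ B (le_max_left i j) hi) z hz (greedySet_mono _ B (le_max_right i j) hj)
  · have hfree' : ∀ᵐ x ∂μ, ∀ z ∈ F, z +ᵥ x ≠ x := by
      simpa using (Finset.eventually_all F).2 hfree
    filter_upwards [hfree'] with x hx
    -- The points `z +ᵥ x` with `z ∈ F` are finitely many and differ from `x`, so a small rational
    -- interval around `φ x` avoids their images.
    obtain ⟨i, hi⟩ : ∃ i, x ∈ B i := by
      have hne : ∀ᶠ t in 𝓝 (φ x), ∀ z ∈ F, t ≠ φ (z +ᵥ x) := by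
        refine (Finset.eventually_all F).2 fun z hz => ?_
        exact isOpen_ne.mem_nhds fun h => hx z hz (hφ.injective h).symm
      obtain ⟨r, hr, hball⟩ := Metric.eventually_nhds_iff.1 hne
      obtain ⟨a, ha1, ha2⟩ := exists_rat_btwn (show φ x - r < φ x by linarith)
      obtain ⟨b, hb1, hb2⟩ := exists_rat_btwn (show φ x < φ x + r by linarith)
      obtain ⟨i, hi⟩ := he (a, b)
      refine ⟨i, ?_, fun z hz h => ?_⟩
      · simp only [I, hi]
        exact ⟨ha2, hb1⟩
      · simp only [I, hi] at h
        refine hball (y := φ (z +ᵥ x)) ?_ z hz rfl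
        rw [Real.dist_eq, abs_lt]
        constructor <;> linarith [h.1, h.2]
    by_cases h : ∀ z ∈ (F : Set G), z +ᵥ x ∉ greedySet (F : Set G) B i
    · left
      exact Set.mem_iUnion.2 ⟨i + 1, Or.inr ⟨hi, h⟩⟩
    · right
      push Not at h
      obtain ⟨z, hz, h⟩ := h
      exact ⟨z, hz, Set.mem_iUnion.2 ⟨i, h⟩⟩

section Tower

variable {d : ℕ} {X : Type*} [MeasurableSpace X] [StandardBorelSpace X]
  {μ : Measure X} [IsProbabilityMeasure μ] [AddAction (Fin d → ℤ) X]
  [MeasurableConstVAdd (Fin d → ℤ) X] [VAddInvariantMeasure (Fin d → ℤ) X μ]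

/-- For a free action there is a set whose translates by `Q_{2n}` are disjoint and which has
measure at least `(5n)^{-d}`. -/
theorem exists_tower_base (hfree : ∀ z : Fin d → ℤ, z ≠ 0 → ∀ᵐ x ∂μ, z +ᵥ x ≠ x)
    {n : ℕ} (hn : 1 ≤ n) :
    ∃ A : Set X, MeasurableSet A ∧
      (∀ z ∈ cubeQ d (2 * n), ∀ w ∈ cubeQ d (2 * n), ∀ x, -z +ᵥ x ∈ A → -w +ᵥ x ∈ A → z = w) ∧
      ((5 * (n : ℝ)) ^ d)⁻¹ ≤ μ.real A ∧ μ.real A ≤ ((2 * (n : ℝ)) ^ d)⁻¹ := by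
  -- `F0` contains all differences of points of `Q_{2n}`, so separation along `F0` makes the
  -- translates disjoint (upper bound for `μ A`). Maximality makes the at most `(5n)^d` translates
  -- by `F0` cover the space (lower bound).
  set F0 : Finset (Fin d → ℤ) := Fintype.piFinset fun _ => Finset.Icc (-(2 * n : ℤ)) (2 * n)
    with hF0
  have hmem : ∀ z, z ∈ F0 ↔ ∀ i, -(2 * n : ℤ) ≤ z i ∧ z i ≤ 2 * n := by
    intro z; simp [hF0]
  have hcard : (F0.card : ℝ) ≤ (5 * (n : ℝ)) ^ d := by
    have h1 : F0.card = (4 * n + 1) ^ d := by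
      simp only [hF0, Fintype.card_piFinset, Int.card_Icc, Finset.prod_const, Finset.card_univ,
        Fintype.card_fin]
      congr 1
      omega
    rw [h1]
    have h2 : (4 * n + 1) ^ d ≤ (5 * n) ^ d := Nat.pow_le_pow_left (by omega) d
    exact_mod_cast h2
  obtain ⟨A, hA, hdisj, hcov⟩ := exists_maximal_separated (μ := μ) (F0.erase 0)
    (fun z hz => by
      rw [Finset.mem_erase] at hz ⊢
      refine ⟨neg_ne_zero.2 hz.1, ?_⟩
      rw [hmem] at *
      intro i
      have := hz.2 i
      simp only [Pi.neg_apply]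
      omega)
    (fun z hz => hfree z (Finset.ne_of_mem_erase hz))
  have hd : ∀ z ∈ cubeQ d (2 * n), ∀ w ∈ cubeQ d (2 * n), ∀ x,
      -z +ᵥ x ∈ A → -w +ᵥ x ∈ A → z = w := by
    intro z hz w hw x h1 h2
    by_contra hzw
    refine hdisj _ h1 (z - w) ?_ ?_
    · rw [Finset.mem_erase, hmem]
      refine ⟨sub_ne_zero.2 hzw, fun i => ?_⟩
      have h3 := mem_cubeQ.1 hz i
      have h4 := mem_cubeQ.1 hw i
      push_cast at h3 h4
      simp only [Pi.sub_apply]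
      omega
    · rw [vadd_vadd]
      convert h2 using 2
      abel
  refine ⟨A, hA, hd, ?_, ?_⟩
  · have h1 : (Set.univ : Set X) ≤ᵐ[μ] ⋃ z ∈ F0, {x | z +ᵥ x ∈ A} := by
      filter_upwards [hcov] with x hx _
      change x ∈ ⋃ z ∈ F0, {x | z +ᵥ x ∈ A}
      simp only [Set.mem_iUnion]
      rcases hx with hx | ⟨z, hz, hx⟩
      · refine ⟨0, (hmem 0).2 fun i => ?_, by simpa using hx⟩
        simp only [Pi.zero_apply]
        omega
      · exact ⟨z, Finset.mem_of_mem_erase hz, hx⟩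
    have h2 : 1 ≤ μ.real (⋃ z ∈ F0, {x | z +ᵥ x ∈ A}) := by
      have := ENNReal.toReal_mono (measure_ne_top μ _) (measure_mono_ae h1)
      simpa using! this
    have h3 : μ.real (⋃ z ∈ F0, {x | z +ᵥ x ∈ A}) ≤ ∑ z ∈ F0, μ.real {x | z +ᵥ x ∈ A} :=
      measureReal_biUnion_finset_le _ _
    simp only [measureReal_preimage_vadd, Finset.sum_const, nsmul_eq_mul] at h3
    have h4 : (0 : ℝ) < (5 * (n : ℝ)) ^ d := by positivity
    rw [inv_le_iff_one_le_mul₀' h4]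
    exact (h2.trans h3).trans (mul_le_mul_of_nonneg_right hcard measureReal_nonneg)
  · have h3 : μ.real (⋃ z ∈ cubeQ d (2 * n), {x | -z +ᵥ x ∈ A})
        = ∑ z ∈ cubeQ d (2 * n), μ.real {x | -z +ᵥ x ∈ A} := by
      refine measureReal_biUnion_finset ?_ fun z _ => measurable_const_vadd (-z) hA
      intro z hz w hw hzw
      exact Set.disjoint_left.2 fun x hx hx' => hzw (hd z hz w hw x hx hx')
    simp only [measureReal_preimage_vadd, Finset.sum_const, nsmul_eq_mul, card_cubeQ] at h3
    have h4 : (0 : ℝ) < (2 * (n : ℝ)) ^ d := by positivity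
    have h5 : μ.real (⋃ z ∈ cubeQ d (2 * n), {x | -z +ᵥ x ∈ A}) ≤ 1 := measureReal_le_one
    rw [h3] at h5
    push_cast at h5
    rw [← one_div, le_div_iff₀ h4]
    linarith

/-- For a free action there are almost invariant sets whose measures are bounded away from
`0` and `1`. -/
theorem exists_almost_invariant_set (hfree : ∀ z : Fin d → ℤ, z ≠ 0 → ∀ᵐ x ∂μ, z +ᵥ x ≠ x)
    (R : ℕ) {δ : ℝ} (hδ : 0 < δ) :
    ∃ E : Set X, MeasurableSet E ∧ ((5 : ℝ) ^ d)⁻¹ ≤ μ.real E ∧ μ.real E ≤ ((2 : ℝ) ^ d)⁻¹ ∧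
      ∀ w ∈ cubeQ d R, μ.real {x | ¬(w +ᵥ x ∈ E ↔ x ∈ E)} ≤ δ := by
  have hev : ∀ᶠ n : ℕ in atTop, ∀ w ∈ cubeQ d R,
      (((cubeQ d n).filter fun z => z + w ∉ cubeQ d n).card : ℝ) / (n : ℝ) ^ d < δ / 2 ∧
      (((cubeQ d n).filter fun z => z + -w ∉ cubeQ d n).card : ℝ) / (n : ℝ) ^ d < δ / 2 := by
    refine (Finset.eventually_all _).2 fun w _ => ?_
    exact ((tendsto_card_cubeQ_boundary w).eventually_lt_const (by positivity)).and
      ((tendsto_card_cubeQ_boundary (-w)).eventually_lt_const (by positivity))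
  obtain ⟨n, hn, hn1⟩ := (hev.and (eventually_ge_atTop 1)).exists
  obtain ⟨A, hA, hdisj, hA1, hA2⟩ := exists_tower_base hfree hn1
  have hnd : (0 : ℝ) < (n : ℝ) ^ d := by positivity
  -- Only the translates by `Q_n`, not by all of `Q_{2n}`, are used; this keeps the measure at most
  -- `2^{-d}`.
  have hE : {x | ∃ z ∈ cubeQ d n, -z +ᵥ x ∈ A} = ⋃ z ∈ cubeQ d n, {x | -z +ᵥ x ∈ A} := by
    ext x; simp
  have hμE : μ.real {x | ∃ z ∈ cubeQ d n, -z +ᵥ x ∈ A} = (n : ℝ) ^ d * μ.real A := by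
    rw [hE, measureReal_biUnion_finset]
    · simp [measureReal_preimage_vadd, card_cubeQ]
    · intro z hz w hw hzw
      refine Set.disjoint_left.2 fun x hx hx' => hzw (hdisj z ?_ w ?_ x hx hx')
      · exact cubeQ_mono (by omega) hz
      · exact cubeQ_mono (by omega) hw
    · exact fun z _ => measurable_const_vadd (-z) hA
  refine ⟨{x | ∃ z ∈ cubeQ d n, -z +ᵥ x ∈ A}, ?_, ?_, ?_, ?_⟩
  · rw [hE]
    exact (cubeQ d n).measurableSet_biUnion fun z _ => measurable_const_vadd (-z) hA
  · rw [hμE]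
    rw [mul_pow, mul_inv] at hA1
    calc ((5 : ℝ) ^ d)⁻¹ = (n : ℝ) ^ d * (((5 : ℝ) ^ d)⁻¹ * ((n : ℝ) ^ d)⁻¹) := by field_simp
      _ ≤ _ := by gcongr
  · rw [hμE]
    rw [mul_pow, mul_inv] at hA2
    calc _ ≤ (n : ℝ) ^ d * (((2 : ℝ) ^ d)⁻¹ * ((n : ℝ) ^ d)⁻¹) := by gcongr
      _ = ((2 : ℝ) ^ d)⁻¹ := by field_simp
  · intro w hw
    obtain ⟨h1, h2⟩ := hn w hw
    have hμA : μ.real A ≤ ((n : ℝ) ^ d)⁻¹ := hA2.trans (by gcongr; linarith)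
    -- A point enters or leaves the set under `w` only from a level of the tower near the boundary
    -- of the cube.
    have hsub : {x | ¬(w +ᵥ x ∈ {x | ∃ z ∈ cubeQ d n, -z +ᵥ x ∈ A} ↔
          x ∈ {x | ∃ z ∈ cubeQ d n, -z +ᵥ x ∈ A})} ⊆
        (⋃ z ∈ (cubeQ d n).filter fun z => z + -w ∉ cubeQ d n, {x | (-z + w) +ᵥ x ∈ A}) ∪
        ⋃ z ∈ (cubeQ d n).filter fun z => z + w ∉ cubeQ d n, {x | -z +ᵥ x ∈ A} := by
      intro x hx
      simp only [Set.mem_ofPred_eq] at hx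
      by_cases hxE : ∃ z ∈ cubeQ d n, -z +ᵥ x ∈ A
      · right
        have hwx : ¬∃ z ∈ cubeQ d n, -z +ᵥ (w +ᵥ x) ∈ A := fun h => hx (iff_of_true h hxE)
        obtain ⟨z, hz, hzA⟩ := hxE
        simp only [Set.mem_iUnion, Finset.mem_filter]
        refine ⟨z, ⟨hz, fun hzw => hwx ⟨z + w, hzw, ?_⟩⟩, hzA⟩
        rw [vadd_vadd]
        convert hzA using 2
        abel
      · left
        have hwx : ∃ z ∈ cubeQ d n, -z +ᵥ (w +ᵥ x) ∈ A := by
          by_contra h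
          exact hx (iff_of_false h hxE)
        obtain ⟨z, hz, hzA⟩ := hwx
        rw [vadd_vadd] at hzA
        simp only [Set.mem_iUnion, Finset.mem_filter]
        refine ⟨z, ⟨hz, fun hzw => hxE ⟨z + -w, hzw, ?_⟩⟩, hzA⟩
        convert hzA using 2
        abel
    have hbound : ∀ (s : Finset (Fin d → ℤ)) (v : (Fin d → ℤ) → Fin d → ℤ),
        (s.card : ℝ) / (n : ℝ) ^ d < δ / 2 → μ.real (⋃ z ∈ s, {x | v z +ᵥ x ∈ A}) ≤ δ / 2 := by
      intro s v hs
      refine (measureReal_biUnion_finset_le _ _).trans ?_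
      simp only [measureReal_preimage_vadd, Finset.sum_const, nsmul_eq_mul]
      refine le_trans ?_ hs.le
      rw [div_eq_mul_inv]
      gcongr
    refine (measureReal_mono hsub (measure_ne_top μ _)).trans ((measureReal_union_le _ _).trans ?_)
    have h3 := hbound _ (fun z => -z + w) h2
    have h4 := hbound _ (fun z => -z) h1
    linarith

end Tower

theorem integral_abs_le_of_support {X : Type*} [MeasurableSpace X] {μ : Measure X}
    [IsFiniteMeasure μ] {f : X → ℝ} {C : ℝ} (hC : ∀ x, |f x| ≤ C)
    {S : Set X} (hS : MeasurableSet S) (h : ∀ x, x ∉ S → f x = 0) :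
    ∫ x, |f x| ∂μ ≤ C * μ.real S := by
  have h1 : ∫ x, |f x| ∂μ ≤ ∫ x, S.indicator (fun _ => C) x ∂μ := by
    refine integral_mono_of_nonneg (Eventually.of_forall fun _ => abs_nonneg _)
      ((integrable_const C).indicator hS) (Eventually.of_forall fun x => ?_)
    by_cases hx : x ∈ S
    · simpa [hx] using hC x
    · simp [hx, h x hx]
  refine h1.trans (le_of_eq ?_)
  rw [integral_indicator_const _ hS, smul_eq_mul, mul_comm]

/-! ### Decorrelation of almost invariant functions from averaged ones. -/

section Independence

variable {d : ℕ} {X : Type*} [MeasurableSpace X] {μ : Measure X} [IsProbabilityMeasure μ]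
  [AddAction (Fin d → ℤ) X] [MeasurableConstVAdd (Fin d → ℤ) X]
  [VAddInvariantMeasure (Fin d → ℤ) X μ]

/-- An almost invariant function `φ` is almost uncorrelated with any function whose ergodic
averages are almost constant. -/
theorem abs_integral_mul_sub_le {φ ψ : X → ℝ} (hφ : Measurable φ) (hψ : Measurable ψ) {C δ : ℝ}
    (hφC : ∀ x, |φ x| ≤ C) (hψ1 : ∀ x, |ψ x| ≤ 1) {n : ℕ} (hn : 1 ≤ n)
    (hδ : ∀ z ∈ cubeQ d n, ∫ x, |φ (z +ᵥ x) - φ x| ∂μ ≤ δ) :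
    |∫ x, φ x * ψ x ∂μ - (∫ x, φ x ∂μ) * ∫ x, ψ x ∂μ| ≤
      δ + C * normOne μ fun x => ergAvg d n ψ x - ∫ y, ψ y ∂μ := by
  have hn0 : (0 : ℝ) < (n : ℝ) ^ d := by positivity
  have hint : ∀ {f g : X → ℝ} {A B : ℝ}, Measurable f → Measurable g → (∀ x, |f x| ≤ A) →
      (∀ x, |g x| ≤ B) → Integrable (fun x => f x * g x) μ := by
    intro f g A B hf hg hA hB
    refine integrable_of_abs_le (C := A * B) (hf.mul hg) fun x => ?_
    rw [abs_mul]
    exact mul_le_mul (hA x) (hB x) (abs_nonneg _) ((abs_nonneg _).trans (hA x))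
  -- Translate both factors by `z`, which preserves the integral, then move `φ` back at the cost of
  -- its displacement.
  have h1 : ∀ z ∈ cubeQ d n, |∫ x, φ x * ψ x ∂μ - ∫ x, φ x * ψ (z +ᵥ x) ∂μ| ≤ δ := by
    intro z hz
    rw [← integral_comp_vadd z fun x => φ x * ψ x, ← integral_sub
      (hint (hφ.comp_vadd z) (hψ.comp_vadd z) (fun x => hφC _) fun x => hψ1 _)
      (hint hφ (hψ.comp_vadd z) hφC fun x => hψ1 _)]
    refine (abs_integral_le_integral_abs).trans (le_trans ?_ (hδ z hz))
    refine integral_mono_of_nonneg (Eventually.of_forall fun _ => abs_nonneg _) ?_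
      (Eventually.of_forall fun x => ?_)
    · exact ((integrable_of_abs_le (hφ.comp_vadd z) fun x => hφC _).sub
        (integrable_of_abs_le hφ hφC)).abs
    · simp only
      rw [← sub_mul, abs_mul]
      exact mul_le_of_le_one_right (abs_nonneg _) (hψ1 _)
  have h2 : ∫ x, φ x * ergAvg d n ψ x ∂μ
      = ((n : ℝ) ^ d)⁻¹ * ∑ z ∈ cubeQ d n, ∫ x, φ x * ψ (z +ᵥ x) ∂μ := by
    rw [← integral_finsetSum _ fun z _ => hint hφ (hψ.comp_vadd z) hφC fun x => hψ1 _,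
      ← integral_const_mul]
    refine integral_congr_ae (Eventually.of_forall fun x => ?_)
    simp only [ergAvg, ← Finset.mul_sum]
    ring
  have h3 : |∫ x, φ x * ψ x ∂μ - ∫ x, φ x * ergAvg d n ψ x ∂μ| ≤ δ := by
    have e : ∫ x, φ x * ψ x ∂μ - ∫ x, φ x * ergAvg d n ψ x ∂μ = ((n : ℝ) ^ d)⁻¹ *
        ∑ z ∈ cubeQ d n, (∫ x, φ x * ψ x ∂μ - ∫ x, φ x * ψ (z +ᵥ x) ∂μ) := by
      rw [h2, Finset.sum_sub_distrib, mul_sub]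
      simp only [Finset.sum_const, card_cubeQ, nsmul_eq_mul]
      push_cast
      rw [inv_mul_cancel_left₀ hn0.ne']
    rw [e, abs_mul, abs_of_pos (inv_pos.2 hn0), inv_mul_le_iff₀ hn0]
    refine (Finset.abs_sum_le_sum_abs _ _).trans ((Finset.sum_le_sum h1).trans ?_)
    simp [card_cubeQ]
  have h4 : |∫ x, φ x * ergAvg d n ψ x ∂μ - (∫ x, φ x ∂μ) * ∫ x, ψ x ∂μ| ≤
      C * normOne μ fun x => ergAvg d n ψ x - ∫ y, ψ y ∂μ := by
    rw [← integral_mul_const, ← integral_sub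
      (hint hφ (measurable_ergAvg hψ n) hφC (abs_ergAvg_le hψ1 n))
      ((integrable_of_abs_le hφ hφC).mul_const _)]
    unfold normOne
    rw [← integral_const_mul]
    refine (abs_integral_le_integral_abs).trans ?_
    refine integral_mono_of_nonneg (Eventually.of_forall fun _ => abs_nonneg _) ?_
      (Eventually.of_forall fun x => ?_)
    · exact ((integrable_of_abs_le (measurable_ergAvg hψ n) (abs_ergAvg_le hψ1 n)).sub
        (integrable_const _)).abs.const_mul _
    · simp only
      rw [← mul_sub, abs_mul]
      exact mul_le_mul_of_nonneg_right (hφC x) (abs_nonneg _)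
  have h5 := abs_sub_le (∫ x, φ x * ψ x ∂μ) (∫ x, φ x * ergAvg d n ψ x ∂μ)
    ((∫ x, φ x ∂μ) * ∫ x, ψ x ∂μ)
  linarith

end Independence

/-! ### Almost invariant partitions into small pieces. -/

section Partition

variable {d : ℕ} {X : Type*} [MeasurableSpace X] [StandardBorelSpace X]
  {μ : Measure X} [IsProbabilityMeasure μ] [AddAction (Fin d → ℤ) X]
  [MeasurableConstVAdd (Fin d → ℤ) X] [ErgodicVAdd (Fin d → ℤ) X μ]

/-- Each step cuts the partition by an almost invariant set almost independent of it. The set and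
its complement have measure at most `1 - 5^{-d}`; halving the gain absorbs the error of
independence. -/
theorem exists_almost_invariant_partition_pow (hd : 1 ≤ d)
    (hfree : ∀ z : Fin d → ℤ, z ≠ 0 → ∀ᵐ x ∂μ, z +ᵥ x ≠ x) (m : ℕ) :
    ∀ (R : ℕ) (δ : ℝ), 0 < δ → ∃ U : X → ℕ, Measurable U ∧ (∃ M, ∀ x, U x < M) ∧
      (∀ z ∈ cubeQ d R, μ.real {x | U (z +ᵥ x) ≠ U x} ≤ δ) ∧
      ∀ i, μ.real {x | U x = i} ≤ (1 - ((5 : ℝ) ^ d)⁻¹ / 2) ^ m := by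
  induction m with
  | zero =>
    intro R δ hδ
    refine ⟨fun _ => 0, measurable_const, ⟨1, fun _ => one_pos⟩, fun z _ => ?_, fun i => ?_⟩
    · simpa using hδ.le
    · simp
  | succ m ih =>
    intro R δ hδ
    obtain ⟨U, hU, ⟨M, hM⟩, hUinv, hUq⟩ := ih R (δ / 2) (by positivity)
    set c : ℝ := ((5 : ℝ) ^ d)⁻¹ with hc
    have hc0 : 0 < c := by positivity
    have hc5 : c ≤ 1 / 5 := by
      rw [hc, ← one_div]
      exact one_div_le_one_div_of_le (by norm_num) (by simpa using pow_le_pow_right₀ (a := (5 : ℝ)) (by norm_num) hd)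
    have h25 : ((2 : ℝ) ^ d)⁻¹ ≤ 1 / 2 := by
      rw [← one_div]
      exact one_div_le_one_div_of_le (by norm_num) (by simpa using pow_le_pow_right₀ (a := (2 : ℝ)) (by norm_num) hd)
    have hq0 : 0 < (1 - c / 2) ^ m := pow_pos (by linarith) m
    set η : ℝ := c / 4 * (1 - c / 2) ^ m with hη
    have hη0 : 0 < η := by positivity
    have hUm : ∀ i, MeasurableSet {x | U x = i} := fun i => hU (measurableSet_singleton i)
    let ψ : ℕ → X → ℝ := fun i => {x | U x = i}.indicator 1
    have hψm : ∀ i, Measurable (ψ i) := fun i => measurable_one.indicator (hUm i)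
    have hψ1 : ∀ i x, |ψ i x| ≤ 1 := by
      intro i x
      by_cases h : x ∈ {x | U x = i} <;> simp [ψ, h]
    have hψi : ∀ i, ∫ x, ψ i x ∂μ = μ.real {x | U x = i} := fun i =>
      integral_indicator_one (hUm i)
    have hev : ∀ᶠ n in atTop, ∀ i ∈ Finset.range M,
        normOne μ (fun x => ergAvg d n (ψ i) x - ∫ y, ψ i y ∂μ) < η :=
      (Finset.eventually_all _).2 fun i _ =>
        (tendsto_normOne_ergAvg (hψm i) (hψ1 i)).eventually_lt_const hη0
    obtain ⟨n, hn, hn1⟩ := (hev.and (eventually_ge_atTop 1)).exists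
    -- The set is chosen after the averaging length `n` for the old partition; its invariance along
    -- `Q_n` gives the independence, along `Q_R` that of the new labels.
    obtain ⟨E, hE, hE1, hE2, hEinv⟩ := exists_almost_invariant_set hfree (max R n)
      (show 0 < min (δ / 2) η by positivity)
    have hEφ : Measurable (E.indicator (1 : X → ℝ)) := measurable_one.indicator hE
    have hEφ1 : ∀ x, |E.indicator (1 : X → ℝ) x| ≤ 1 := by
      intro x
      by_cases h : x ∈ E <;> simp [h]
    have hEm : ∀ z : Fin d → ℤ, MeasurableSet {x | ¬(z +ᵥ x ∈ E ↔ x ∈ E)} := fun z =>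
      ((measurable_const_vadd z hE).mem.iff hE.mem).not.setOf
    have hkey : ∀ i, |μ.real ({x | U x = i} ∩ E) - μ.real E * μ.real {x | U x = i}| ≤ 2 * η := by
      intro i
      by_cases hi : i < M
      · have h1 := abs_integral_mul_sub_le (d := d) (μ := μ) hEφ (hψm i) hEφ1 (hψ1 i) hn1 (δ := η) ?_
        · rw [integral_indicator_one hE, hψi] at h1
          have h2 : ∫ x, E.indicator 1 x * ψ i x ∂μ = μ.real ({x | U x = i} ∩ E) := by
            rw [← integral_indicator_one ((hUm i).inter hE), Set.inter_indicator_one]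
            refine integral_congr_ae (Eventually.of_forall fun x => ?_)
            simp only [Pi.mul_apply]
            exact mul_comm _ _
          rw [h2] at h1
          have h3 := hn i (Finset.mem_range.2 hi)
          rw [hψi] at h3
          linarith
        · intro z hz
          have h2 := hEinv z (cubeQ_mono (le_max_right _ _) hz)
          refine (integral_abs_le_of_support (C := 1) ?_ (hEm z) ?_).trans
            ((one_mul _).trans_le (h2.trans (min_le_right _ _)))
          · intro x
            by_cases h : x ∈ E <;> by_cases h' : z +ᵥ x ∈ E <;> simp [h, h']
          · intro x hx
            have hx' : z +ᵥ x ∈ E ↔ x ∈ E := by simpa using hx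
            by_cases h : x ∈ E
            · simp [h, hx'.2 h]
            · simp [h, mt hx'.1 h]
      · have h1 : {x | U x = i} = ∅ := by
          ext x
          have := hM x
          simp
          omega
        rw [h1]
        simp
        positivity
    have hb : ∀ x, E.indicator (1 : X → ℕ) x = 0 ∨ E.indicator (1 : X → ℕ) x = 1 := by
      intro x
      by_cases h : x ∈ E <;> simp [h]
    have hstep : ∀ p e : ℝ, 0 ≤ p → p ≤ (1 - c / 2) ^ m → e ≤ 1 - c → p * e + 2 * η ≤
        (1 - c / 2) ^ (m + 1) := by
      intro p e hp0 hp he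
      have : p * e ≤ (1 - c / 2) ^ m * (1 - c) :=
        (mul_le_mul_of_nonneg_left he hp0).trans (mul_le_mul_of_nonneg_right hp (by linarith))
      rw [pow_succ, hη]
      linarith
    -- The new label encodes the pair of old label and membership in `E`: half of it, rounded down,
    -- is the former, its parity the latter.
    refine ⟨fun x => 2 * U x + E.indicator 1 x, ?_, ⟨2 * M, fun x => ?_⟩, fun z hz => ?_,
      fun k => ?_⟩
    · exact (hU.const_mul 2).add (measurable_one.indicator hE)
    · have := hM x
      have := hb x
      change 2 * U x + E.indicator 1 x < 2 * M
      omega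
    · have hsub : {x | 2 * U (z +ᵥ x) + E.indicator 1 (z +ᵥ x) ≠ 2 * U x + E.indicator 1 x} ⊆
          {x | U (z +ᵥ x) ≠ U x} ∪ {x | ¬(z +ᵥ x ∈ E ↔ x ∈ E)} := by
        intro x hx
        by_contra hcon
        simp only [Set.mem_union, Set.mem_ofPred_eq, not_or, not_not] at hcon
        apply hx
        rw [hcon.1]
        congr 1
        by_cases h : x ∈ E
        · simp [h, hcon.2.2 h]
        · simp [h, mt hcon.2.1 h]
      refine (measureReal_mono hsub (measure_ne_top μ _)).trans
        ((measureReal_union_le _ _).trans ?_)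
      have h1 := hUinv z hz
      have h2 := (hEinv z (cubeQ_mono (le_max_left _ _) hz)).trans (min_le_left _ _)
      linarith
    · have h1 := abs_le.1 (hkey (k / 2))
      have h2 := measureReal_inter_add_sdiff (μ := μ) (s := {x | U x = k / 2}) hE
      have h3 := hUq (k / 2)
      rcases Nat.mod_two_eq_zero_or_one k with hk | hk
      · have hsub : {x | 2 * U x + E.indicator 1 x = k} ⊆ {x | U x = k / 2} \ E := by
          intro x hx
          have hx' : 2 * U x + E.indicator 1 x = k := hx
          have := hb x
          refine ⟨show U x = k / 2 by omega, fun h => ?_⟩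
          have : E.indicator (1 : X → ℕ) x = 1 := by simp [h]
          omega
        refine (measureReal_mono hsub (measure_ne_top μ _)).trans ?_
        refine le_trans ?_ (hstep _ (1 - μ.real E) measureReal_nonneg h3 (by linarith))
        linarith
      · have hsub : {x | 2 * U x + E.indicator 1 x = k} ⊆ {x | U x = k / 2} ∩ E := by
          intro x hx
          have hx' : 2 * U x + E.indicator 1 x = k := hx
          have := hb x
          refine ⟨show U x = k / 2 by omega, ?_⟩
          by_contra h
          have : E.indicator (1 : X → ℕ) x = 0 := by simp [h]
          omega
        refine (measureReal_mono hsub (measure_ne_top μ _)).trans ?_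
        refine le_trans ?_ (hstep _ (μ.real E) measureReal_nonneg h3 (by linarith))
        linarith

/-- For a free ergodic action there are almost invariant finite partitions into sets of
small measure. -/
theorem exists_almost_invariant_partition (hd : 1 ≤ d)
    (hfree : ∀ z : Fin d → ℤ, z ≠ 0 → ∀ᵐ x ∂μ, z +ᵥ x ≠ x) (R : ℕ) {δ : ℝ} (hδ : 0 < δ) :
    ∃ U : X → ℕ, Measurable U ∧ (∃ M, ∀ x, U x < M) ∧
      (∀ z ∈ cubeQ d R, μ.real {x | U (z +ᵥ x) ≠ U x} ≤ δ) ∧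
      ∀ i, μ.real {x | U x = i} ≤ δ := by
  have h5 : (1 : ℝ) ≤ 5 ^ d := one_le_pow₀ (by norm_num)
  have h0 : (0 : ℝ) < ((5 : ℝ) ^ d)⁻¹ := by positivity
  have h1 : ((5 : ℝ) ^ d)⁻¹ ≤ 1 := inv_le_one_of_one_le₀ h5
  obtain ⟨m, hm⟩ := exists_pow_lt_of_lt_one hδ
    (show 1 - ((5 : ℝ) ^ d)⁻¹ / 2 < 1 by linarith)
  obtain ⟨U, hU, hM, hinv, hq⟩ := exists_almost_invariant_partition_pow hd hfree m R δ hδ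
  exact ⟨U, hU, hM, hinv, fun i => (hq i).trans hm.le⟩

end Partition

/-! ### Realizing prescribed finite distributions. -/

section Grouping

/-- If the total first reaches `p` when `a` is added, the sum without `a` falls short of `p` by at
most one weight. -/
theorem exists_subset_sum_approx {ι : Type*} [DecidableEq ι] {w : ι → ℝ} {η p : ℝ} (hη : 0 ≤ η)
    (hwη : ∀ i, w i ≤ η) (hp : 0 ≤ p) (S : Finset ι) (hS : p ≤ ∑ i ∈ S, w i) :
    ∃ T ⊆ S, p - η ≤ ∑ i ∈ T, w i ∧ ∑ i ∈ T, w i ≤ p := by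
  induction S using Finset.induction_on with
  | empty =>
    have h1 : p ≤ 0 := by simpa using hS
    exact ⟨∅, Finset.Subset.refl _, by simp; linarith, by simpa using hp⟩
  | insert a S ha ih =>
    by_cases h : p ≤ ∑ i ∈ S, w i
    · obtain ⟨T, hT, h1, h2⟩ := ih h
      exact ⟨T, hT.trans (Finset.subset_insert a S), h1, h2⟩
    · push Not at h
      rw [Finset.sum_insert ha] at hS
      have := hwη a
      exact ⟨S, Finset.subset_insert a S, by linarith, h.le⟩

/-- Small weights can be grouped into prescribed ones. -/
theorem exists_grouping {ι κ : Type*} [DecidableEq ι] [DecidableEq κ] [Nonempty κ] {w : ι → ℝ}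
    {η : ℝ} (hη : 0 ≤ η) (hw0 : ∀ i, 0 ≤ w i) (hwη : ∀ i, w i ≤ η) {p : κ → ℝ}
    (hp : ∀ j, 0 ≤ p j) (s : Finset κ) :
    ∀ S : Finset ι, ∑ j ∈ s, p j ≤ ∑ i ∈ S, w i →
      ∃ σ : ι → κ, ∀ j ∈ s, p j - η ≤ ∑ i ∈ S with σ i = j, w i := by
  induction s using Finset.induction_on with
  | empty => exact fun S _ => ⟨fun _ => Classical.arbitrary κ, by simp⟩
  | insert a s ha ih =>
    intro S hS
    rw [Finset.sum_insert ha] at hS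
    have h0 : 0 ≤ ∑ j ∈ s, p j := Finset.sum_nonneg fun j _ => hp j
    obtain ⟨T, hT, hT1, hT2⟩ := exists_subset_sum_approx hη hwη (hp a) S (by linarith)
    have h1 := Finset.sum_sdiff (f := w) hT
    obtain ⟨σ, hσ⟩ := ih (S \ T) (by linarith)
    refine ⟨fun i => if i ∈ T then a else σ i, fun j hj => ?_⟩
    rcases Finset.mem_insert.1 hj with rfl | hj
    · refine hT1.trans (Finset.sum_le_sum_of_subset_of_nonneg (fun i hi => ?_) fun i _ _ => hw0 i)
      simp [hi, hT hi]
    · refine (hσ j hj).trans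
        (Finset.sum_le_sum_of_subset_of_nonneg (fun i hi => ?_) fun i _ _ => hw0 i)
      simp only [Finset.mem_filter, Finset.mem_sdiff] at hi ⊢
      simp [hi.1.1, hi.1.2, hi.2]

end Grouping

section Realization

variable {d : ℕ} {X : Type*} [MeasurableSpace X] [StandardBorelSpace X]
  {μ : Measure X} [IsProbabilityMeasure μ] [AddAction (Fin d → ℤ) X]
  [MeasurableConstVAdd (Fin d → ℤ) X] [ErgodicVAdd (Fin d → ℤ) X μ]

/-- For a free ergodic action there are almost invariant finite partitions with almost
prescribed measures. -/
theorem exists_almost_invariant_labelling (hd : 1 ≤ d)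
    (hfree : ∀ z : Fin d → ℤ, z ≠ 0 → ∀ᵐ x ∂μ, z +ᵥ x ≠ x) {κ : Type*} [Fintype κ]
    {p : κ → ℝ} (hp : ∀ j, 0 ≤ p j) (hp1 : ∑ j, p j = 1) (R : ℕ) {δ : ℝ} (hδ : 0 < δ) :
    ∃ s : X → κ, (∀ T : Set κ, MeasurableSet (s ⁻¹' T)) ∧
      (∀ z ∈ cubeQ d R, μ.real {x | s (z +ᵥ x) ≠ s x} ≤ δ) ∧
      ∀ j, p j - δ ≤ μ.real {x | s x = j} := by
  classical
  have : Nonempty κ := by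
    by_contra h
    rw [not_nonempty_iff] at h
    simp at hp1
  obtain ⟨U, hU, ⟨M, hM⟩, hinv, hsmall⟩ :=
    exists_almost_invariant_partition (μ := μ) hd hfree R hδ
  have hUm : ∀ i, MeasurableSet {x | U x = i} := fun i => hU (measurableSet_singleton i)
  have hdisj : ∀ S : Finset ℕ, (S : Set ℕ).PairwiseDisjoint fun i => {x | U x = i} := by
    intro S i _ j _ hij
    exact Set.disjoint_left.2 fun x (hx : U x = i) (hx' : U x = j) => hij (hx.symm.trans hx')
  have hsum : ∑ i ∈ Finset.range M, μ.real {x | U x = i} = 1 := by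
    rw [← measureReal_biUnion_finset (hdisj _) fun i _ => hUm i]
    have : (⋃ i ∈ Finset.range M, {x | U x = i}) = Set.univ := by
      ext x
      simpa using hM x
    rw [this]
    simp
  obtain ⟨σ, hσ⟩ := exists_grouping hδ.le (fun i => measureReal_nonneg) hsmall hp Finset.univ
    (Finset.range M) (by rw [hsum, hp1])
  refine ⟨fun x => σ (U x), fun T => hU (MeasurableSet.of_discrete (s := σ ⁻¹' T)), fun z hz => ?_,
    fun j => ?_⟩
  · refine (measureReal_mono ?_ (measure_ne_top μ _)).trans (hinv z hz)
    intro x hx h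
    exact hx (congrArg σ h)
  · refine (hσ j (Finset.mem_univ j)).trans ?_
    rw [← measureReal_biUnion_finset (hdisj _) fun i _ => hUm i]
    refine measureReal_mono ?_ (measure_ne_top μ _)
    intro x hx
    simp only [Set.mem_iUnion, Finset.mem_filter] at hx
    obtain ⟨i, ⟨_, hi⟩, hx⟩ := hx
    change σ (U x) = j
    rw [show U x = i from hx, hi]

end Realization

/-! ### Integration of functions of a finite label. -/

section Labels

theorem pairwise_disjoint_fibers {Ω κ : Type*} (s : Ω → κ) :
    Pairwise (Function.onFun Disjoint fun j => {x | s x = j}) := by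
  intro i j hij
  exact Set.disjoint_left.2 fun x (hx : s x = i) (hx' : s x = j) => hij (hx.symm.trans hx')

theorem iUnion_fibers {Ω κ : Type*} (s : Ω → κ) : (⋃ j, {x | s x = j}) = Set.univ := by
  ext x; simp

theorem measurable_comp_label {Ω κ : Type*} [MeasurableSpace Ω] {s : Ω → κ}
    (hs : ∀ T : Set κ, MeasurableSet (s ⁻¹' T)) {β : Type*}
    [MeasurableSpace β] (F : κ → β) : Measurable fun x => F (s x) :=
  fun T _ => hs (F ⁻¹' T)

theorem measurableSet_fiber {Ω κ : Type*} [MeasurableSpace Ω] {s : Ω → κ}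
    (hs : ∀ T : Set κ, MeasurableSet (s ⁻¹' T)) (j : κ) : MeasurableSet {x | s x = j} :=
  hs {j}

theorem exists_bound_of_fintype {κ : Type*} [Fintype κ] (F : κ → ℝ) : ∃ C, 0 ≤ C ∧ ∀ j, |F j| ≤ C :=
  ⟨∑ j, |F j|, Finset.sum_nonneg fun _ _ => abs_nonneg _, fun j =>
    Finset.single_le_sum (f := fun j => |F j|) (fun _ _ => abs_nonneg _) (Finset.mem_univ j)⟩

variable {Ω κ : Type*} [MeasurableSpace Ω] {μ : Measure Ω} [Fintype κ] {s : Ω → κ}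

theorem sum_setIntegral_fibers (hs : ∀ T : Set κ, MeasurableSet (s ⁻¹' T)) {f : Ω → ℝ}
    (hf : Integrable f μ) : ∑ j, ∫ x in {x | s x = j}, f x ∂μ = ∫ x, f x ∂μ := by
  rw [← integral_iUnion_fintype (measurableSet_fiber hs) (pairwise_disjoint_fibers s)
    (fun j => hf.integrableOn), iUnion_fibers, Measure.restrict_univ]

variable [IsProbabilityMeasure μ]

theorem sum_measureReal_fibers (hs : ∀ T : Set κ, MeasurableSet (s ⁻¹' T)) :
    ∑ j, μ.real {x | s x = j} = 1 := by
  have := sum_setIntegral_fibers (μ := μ) hs (integrable_const (1 : ℝ))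
  simpa using this

theorem integral_comp_label (hs : ∀ T : Set κ, MeasurableSet (s ⁻¹' T)) (F : κ → ℝ) :
    ∫ x, F (s x) ∂μ = ∑ j, μ.real {x | s x = j} * F j := by
  obtain ⟨C, _, hC⟩ := exists_bound_of_fintype F
  rw [← sum_setIntegral_fibers hs (integrable_of_abs_le (measurable_comp_label hs F)
    fun x => hC (s x))]
  refine Finset.sum_congr rfl fun j _ => ?_
  rw [setIntegral_congr_fun (g := fun _ => F j) (measurableSet_fiber hs j) fun x (hx : s x = j) => by simp [hx]]
  simp

end Labels

/-! ### Finite approximations with exact mean and first absolute moment. -/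

/-- The finitely supported distribution with weights `p` at the points `v` is centred, has first
absolute moment `a` and support in `[-V, V]`, and is `ε`-close to `ν`. -/
def DiscreteApprox (ν : Measure ℝ) (ε a V : ℝ) {κ : Type} [Fintype κ] (p v : κ → ℝ) : Prop :=
  (∀ j, 0 ≤ p j) ∧ ∑ j, p j = 1 ∧ ∑ j, p j * v j = 0 ∧ ∑ j, p j * |v j| = a ∧ (∀ j, |v j| ≤ V) ∧
    ∀ g : ℝ → ℝ, Measurable g → ∀ C e L : ℝ, 0 ≤ L → (∀ t, |g t| ≤ C) →
      (∀ s t, |g s - g t| ≤ e + L * |s - t|) →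
      |∫ t, g t ∂ν - ∑ j, p j * g (v j)| ≤ e + L * ε + 4 * C * ε

section Discretization

variable {ν : Measure ℝ} [IsProbabilityMeasure ν]

theorem abs_integral_sub_le_of_label {κ : Type} [Fintype κ] {c : ℝ → κ}
    (hc : ∀ T : Set κ, MeasurableSet (c ⁻¹' T)) {v : κ → ℝ} {B : Set ℝ} (hB : MeasurableSet B)
    {ε : ℝ} (hε : 0 ≤ ε) (hBε : ν.real B ≤ ε) (hv : ∀ t, t ∉ B → |t - v (c t)| ≤ ε) {g : ℝ → ℝ}
    (hg : Measurable g) {C e L : ℝ} (hL : 0 ≤ L) (hC : ∀ t, |g t| ≤ C)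
    (hgL : ∀ s t, |g s - g t| ≤ e + L * |s - t|) :
    |∫ t, g t ∂ν - ∑ j, ν.real {t | c t = j} * g (v j)| ≤ e + L * ε + 2 * C * ε := by
  have hC0 : 0 ≤ C := (abs_nonneg _).trans (hC 0)
  have he : 0 ≤ e := by simpa using hgL 0 0
  have h1 : Integrable (fun t => g (v (c t))) ν :=
    integrable_of_abs_le (measurable_comp_label hc fun j => g (v j)) fun t => hC _
  rw [← integral_comp_label hc fun j => g (v j), ← integral_sub (integrable_of_abs_le hg hC) h1]
  refine abs_integral_le_integral_abs.trans ?_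
  -- Off `B` the argument moves by at most `ε`; on `B`, of mass at most `ε`, only boundedness is
  -- used.
  have h2 : ∫ t, |g t - g (v (c t))| ∂ν ≤ ∫ t, (e + L * ε + B.indicator (fun _ => 2 * C) t) ∂ν := by
    refine integral_mono_of_nonneg (Eventually.of_forall fun _ => abs_nonneg _)
      ((integrable_const _).add ((integrable_const _).indicator hB))
      (Eventually.of_forall fun t => ?_)
    by_cases ht : t ∈ B
    · simp only [ht, Set.indicator_of_mem]
      have h3 := (abs_sub (g t) (g (v (c t)))).trans (add_le_add (hC t) (hC (v (c t))))
      have : 0 ≤ L * ε := mul_nonneg hL hε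
      linarith
    · simp only [ht, not_false_eq_true, Set.indicator_of_notMem, add_zero]
      exact (hgL _ _).trans (by gcongr; exact hv t ht)
  refine h2.trans ?_
  rw [integral_add (integrable_const _) ((integrable_const _).indicator hB),
    integral_indicator_const _ hB]
  simp only [integral_const, probReal_univ, smul_eq_mul, one_mul]
  nlinarith

/-- The cells of width `ε`, the outermost of the `2 K` cells being unbounded. -/
noncomputable def cellIndex (ε : ℝ) (K : ℕ) (hK : 1 ≤ K) (t : ℝ) :
    Finset.Icc (-(K : ℤ)) (K - 1) :=
  ⟨max (-(K : ℤ)) (min ((K : ℤ) - 1) ⌊t / ε⌋), by rw [Finset.mem_Icc]; omega⟩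

theorem measurableSet_cellIndex_preimage (ε : ℝ) (K : ℕ) (hK : 1 ≤ K)
    (T : Set (Finset.Icc (-(K : ℤ)) (K - 1))) : MeasurableSet (cellIndex ε K hK ⁻¹' T) := by
  have h1 : Measurable fun t : ℝ => ⌊t / ε⌋ := Int.measurable_floor.comp (measurable_id.div_const ε)
  have h2 : cellIndex ε K hK ⁻¹' T = (fun t : ℝ => ⌊t / ε⌋) ⁻¹'
      {i | ∃ h, (⟨max (-(K : ℤ)) (min ((K : ℤ) - 1) i), h⟩ : Finset.Icc (-(K : ℤ)) (K - 1)) ∈ T} := by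
    ext t
    constructor
    · exact fun h => ⟨_, h⟩
    · rintro ⟨_, h⟩
      exact h
  rw [h2]
  exact h1 (MeasurableSet.of_discrete)

/-- The points outside the inner cells. -/
def cellTail (ε : ℝ) (K : ℕ) : Set ℝ := {t | ¬(-(K : ℤ) + 1 ≤ ⌊t / ε⌋ ∧ ⌊t / ε⌋ ≤ (K : ℤ) - 2)}

theorem measurableSet_cellTail (ε : ℝ) (K : ℕ) : MeasurableSet (cellTail ε K) := by
  have h1 : Measurable fun t : ℝ => ⌊t / ε⌋ := Int.measurable_floor.comp (measurable_id.div_const ε)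
  exact h1 (MeasurableSet.of_discrete (s := {i | ¬(-(K : ℤ) + 1 ≤ i ∧ i ≤ (K : ℤ) - 2)}))

theorem exists_cellTail_le (ν : Measure ℝ) [IsProbabilityMeasure ν] {ε : ℝ} (hε : 0 < ε) :
    ∃ K : ℕ, 1 ≤ K ∧ ν.real (cellTail ε K) ≤ ε := by
  have h1 : Tendsto (fun K => ν (cellTail ε K)) atTop (𝓝 (ν (⋂ K, cellTail ε K))) := by
    refine tendsto_measure_iInter_atTop (fun K => (measurableSet_cellTail ε K).nullMeasurableSet)
      ?_ ⟨0, measure_ne_top _ _⟩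
    intro K M hKM t ht h
    exact ht ⟨by omega, by omega⟩
  have h2 : (⋂ K, cellTail ε K) = ∅ := by
    rw [Set.eq_empty_iff_forall_notMem]
    intro t ht
    refine Set.mem_iInter.1 ht (⌊t / ε⌋.natAbs + 2) ⟨?_, ?_⟩ <;>
      simp only [Nat.cast_add, Nat.cast_ofNat] <;> omega
  rw [h2, measure_empty] at h1
  have h3 := (ENNReal.tendsto_toReal ENNReal.zero_ne_top).comp h1
  obtain ⟨K, hK, hK1⟩ := ((h3.eventually_lt_const (by simpa using hε)).and
    (eventually_ge_atTop 1)).exists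
  exact ⟨K, hK1, hK.le⟩

theorem cellIndex_eq_floor {ε : ℝ} {K : ℕ} {hK : 1 ≤ K} {t : ℝ}
    (ht : t ∉ cellTail ε K) : (cellIndex ε K hK t : ℤ) = ⌊t / ε⌋ := by
  simp only [cellTail, Set.mem_ofPred_eq, not_not] at ht
  simp only [cellIndex]
  omega

theorem mem_cell {ε : ℝ} (hε : 0 < ε) {j : ℤ} {t : ℝ} (h : ⌊t / ε⌋ = j) :
    j * ε ≤ t ∧ t ≤ (j + 1) * ε := by
  rw [Int.floor_eq_iff] at h
  rw [le_div_iff₀ hε, div_lt_iff₀ hε] at h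
  exact ⟨h.1, h.2.le⟩

/-- Each cell is replaced by its barycentre. This preserves the mean, and also the first absolute
moment, because no cell has points on both sides of `0`. -/
theorem exists_discreteApprox_of_isNormalized (hν : IsNormalizedDistribution ν) {ε : ℝ}
    (hε : 0 < ε) :
    ∃ (V : ℝ) (κ : Type) (_ : Fintype κ) (p v : κ → ℝ), DiscreteApprox ν ε 1 V p v := by
  obtain ⟨K, hK, hKε⟩ := exists_cellTail_le ν hε
  -- The Bochner integral of a non-integrable function is `0`, which contradicts `∫ |t| = 1`.
  have hid : Integrable (fun t : ℝ => t) ν := by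
    by_contra h
    have h1 : ∫ t, |t| ∂ν = 0 := integral_undef fun h2 =>
      h ((integrable_norm_iff measurable_id.aestronglyMeasurable).1 h2)
    linarith [hν.2]
  set c := cellIndex ε K hK with hc
  have hcm : ∀ T, MeasurableSet (c ⁻¹' T) := measurableSet_cellIndex_preimage ε K hK
  let p : Finset.Icc (-(K : ℤ)) (K - 1) → ℝ := fun j => ν.real {t | c t = j}
  -- The value chosen for a null cell carries no mass.
  let v : Finset.Icc (-(K : ℤ)) (K - 1) → ℝ := fun j =>
    if p j = 0 then (j : ℤ) * ε else (p j)⁻¹ * ∫ t in {t | c t = j}, t ∂ν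
  have hp0 : ∀ j, 0 ≤ p j := fun j => measureReal_nonneg
  have hpv : ∀ j, p j * v j = ∫ t in {t | c t = j}, t ∂ν := by
    intro j
    by_cases h : p j = 0
    · rw [h, zero_mul, setIntegral_measure_zero]
      simpa [p, measureReal_eq_zero_iff] using h
    · simp only [v, h, if_false]
      rw [mul_inv_cancel_left₀ h]
  have hpv' : ∀ j, p j * |v j| = ∫ t in {t | c t = j}, |t| ∂ν := by
    intro j
    rw [← abs_of_nonneg (hp0 j), ← abs_mul, hpv]
    by_cases hj : 0 ≤ (j : ℤ)
    · have h1 : ∀ t ∈ {t | c t = j}, 0 ≤ t := by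
        intro t ht
        have h2 : (c t : ℤ) = j := congrArg Subtype.val ht
        simp only [hc, cellIndex] at h2
        have h3 : 0 ≤ ⌊t / ε⌋ := by omega
        rw [Int.floor_nonneg] at h3
        by_contra h4
        push Not at h4
        exact absurd h3 (not_le.2 (div_neg_of_neg_of_pos h4 hε))
      rw [abs_of_nonneg (setIntegral_nonneg (measurableSet_fiber hcm j) h1)]
      exact setIntegral_congr_fun (measurableSet_fiber hcm j) fun t ht => (abs_of_nonneg (h1 t ht)).symm
    · have h1 : ∀ t ∈ {t | c t = j}, t ≤ 0 := by
        intro t ht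
        have h2 : (c t : ℤ) = j := congrArg Subtype.val ht
        simp only [hc, cellIndex] at h2
        by_contra h4
        push Not at h4
        have h3 : 0 ≤ ⌊t / ε⌋ := Int.floor_nonneg.2 (by positivity)
        omega
      rw [abs_of_nonpos (setIntegral_nonpos (measurableSet_fiber hcm j) h1), ← integral_neg]
      exact setIntegral_congr_fun (measurableSet_fiber hcm j) fun t ht => (abs_of_nonpos (h1 t ht)).symm
  obtain ⟨V, _, hV⟩ := exists_bound_of_fintype v
  refine ⟨V, _, inferInstance, p, v, hp0, sum_measureReal_fibers hcm, ?_, ?_, hV, ?_⟩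
  · simp_rw [hpv]
    rw [sum_setIntegral_fibers hcm hid, hν.1]
  · simp_rw [hpv']
    rw [sum_setIntegral_fibers hcm hid.abs, hν.2]
  · intro g hg C e L hL hC hgL
    have hC0 : 0 ≤ C := (abs_nonneg _).trans (hC 0)
    refine (abs_integral_sub_le_of_label hcm (measurableSet_cellTail ε K) hε.le hKε (fun t ht => ?_)
      hg hL hC hgL).trans (by nlinarith)
    have h1 := mem_cell hε (cellIndex_eq_floor (hK := hK) ht).symm
    have h2 : (c t : ℤ) * ε ≤ v (c t) ∧ v (c t) ≤ ((c t : ℤ) + 1) * ε := by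
      by_cases h : p (c t) = 0
      · simp only [v, h, if_true]
        constructor
        · exact le_refl _
        · linarith
      · have h0 : 0 < p (c t) := lt_of_le_of_ne (hp0 _) (Ne.symm h)
        have hcell : ∀ u ∈ {u | c u = c t}, (c t : ℤ) * ε ≤ u ∧ u ≤ ((c t : ℤ) + 1) * ε := by
          intro u hu
          refine mem_cell hε ?_
          have h3 : (c u : ℤ) = c t := congrArg Subtype.val hu
          rw [hc, cellIndex_eq_floor ht] at h3 ⊢
          simp only [cellIndex] at h3
          simp only [cellTail, Set.mem_ofPred_eq, not_not] at ht
          omega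
        have h4 := setIntegral_mono_on (μ := ν) (s := {u | c u = c t})
          (integrable_const ((c t : ℤ) * ε)).integrableOn hid.integrableOn (measurableSet_fiber hcm (c t))
          fun u hu => (hcell u hu).1
        have h5 := setIntegral_mono_on (μ := ν) (s := {u | c u = c t}) hid.integrableOn
          (integrable_const (((c t : ℤ) + 1) * ε)).integrableOn (measurableSet_fiber hcm (c t))
          fun u hu => (hcell u hu).2
        rw [setIntegral_const, smul_eq_mul, ← hpv] at h4 h5
        exact ⟨le_of_mul_le_mul_left h4 h0, le_of_mul_le_mul_left h5 h0⟩
    rw [abs_le]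
    constructor <;> linarith [h1.1, h1.2, h2.1, h2.2]

/-- No moment of `ν` need exist. The cells are rounded to their grid points, and mass at most `ε` is
moved to two extra points that restore mean zero. -/
theorem exists_discreteApprox_of_measure (ν : Measure ℝ) [IsProbabilityMeasure ν] {ε : ℝ}
    (hε : 0 < ε) :
    ∃ (a V : ℝ) (κ : Type) (_ : Fintype κ) (p v : κ → ℝ), 0 < a ∧ DiscreteApprox ν ε a V p v := by
  obtain ⟨K, hK, hKε⟩ := exists_cellTail_le ν hε
  set c := cellIndex ε K hK with hc
  have hcm : ∀ T, MeasurableSet (c ⁻¹' T) := measurableSet_cellIndex_preimage ε K hK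
  let q : Finset.Icc (-(K : ℤ)) (K - 1) → ℝ := fun j => ν.real {t | c t = j}
  let w : Finset.Icc (-(K : ℤ)) (K - 1) → ℝ := fun j => (j : ℤ) * ε
  have hq0 : ∀ j, 0 ≤ q j := fun j => measureReal_nonneg
  have hq1 : ∑ j, q j = 1 := sum_measureReal_fibers hcm
  set η : ℝ := min ε 1 with hη
  have hη0 : 0 < η := by positivity
  have hη1 : η ≤ 1 := min_le_right _ _
  -- The extra points have average `-S` and total mass `η`, which cancels the mean of the rest. The
  -- summand `1 + |S|` in their definition keeps them away from `0`, so the first absolute moment is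
  -- positive.
  set S : ℝ := (1 - η) * (∑ j, q j * w j) / η with hS
  let p : Finset.Icc (-(K : ℤ)) (K - 1) ⊕ Bool → ℝ := Sum.elim (fun j => (1 - η) * q j) fun _ => η / 2
  let v : Finset.Icc (-(K : ℤ)) (K - 1) ⊕ Bool → ℝ :=
    Sum.elim w fun b => if b then 1 + |S| - S else -(1 + |S| + S)
  obtain ⟨V, _, hV⟩ := exists_bound_of_fintype v
  have hp0 : ∀ j, 0 ≤ p j := by
    rintro (j | b)
    · exact mul_nonneg (by linarith) (hq0 j)
    · simp only [p, Sum.elim_inr]; positivity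
  refine ⟨_, V, _, inferInstance, p, v, ?_, hp0, ?_, ?_, rfl, hV, ?_⟩
  · have h1 : 0 < p (Sum.inr true) * |v (Sum.inr true)| := by
      simp only [p, v, Sum.elim_inr, if_true]
      have := le_abs_self S
      have h2 : 0 < 1 + |S| - S := by linarith
      positivity
    exact h1.trans_le (Finset.single_le_sum (f := fun j => p j * |v j|)
      (fun j _ => mul_nonneg (hp0 j) (abs_nonneg _)) (Finset.mem_univ _))
  · simp only [p, Fintype.sum_sum_type, Sum.elim_inl, Sum.elim_inr, ← Finset.mul_sum, hq1,
      Fintype.sum_bool]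
    ring
  · have h1 : (1 - η) * ∑ j, q j * w j = η * S := by rw [hS]; field_simp
    simp only [p, v, Fintype.sum_sum_type, Sum.elim_inl, Sum.elim_inr, mul_assoc, ← Finset.mul_sum,
      Fintype.sum_bool, h1]
    simp
    ring
  · intro g hg C e L hL hC hgL
    have hC0 : 0 ≤ C := (abs_nonneg _).trans (hC 0)
    have h1 := abs_integral_sub_le_of_label (v := w) hcm (measurableSet_cellTail ε K) hε.le hKε
      (fun t ht => by
        have h1 := mem_cell hε (cellIndex_eq_floor (hK := hK) ht).symm
        simp only [w]
        rw [abs_le]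
        constructor <;> linarith [h1.1, h1.2]) hg hL hC hgL
    have h2 : |∑ j, q j * g (w j)| ≤ C := by
      refine (Finset.abs_sum_le_sum_abs _ _).trans ?_
      calc ∑ j, |q j * g (w j)| ≤ ∑ j, q j * C := by
            refine Finset.sum_le_sum fun j _ => ?_
            rw [abs_mul, abs_of_nonneg (hq0 j)]
            exact mul_le_mul_of_nonneg_left (hC _) (hq0 j)
        _ = C := by rw [← Finset.sum_mul, hq1, one_mul]
    have h3 := hC (1 + |S| - S)
    have h4 := hC (-(1 + |S| + S))
    simp only [p, v, Fintype.sum_sum_type, Sum.elim_inl, Sum.elim_inr, mul_assoc, ← Finset.mul_sum,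
      Fintype.sum_bool, if_true]
    have h5 : η * C ≤ ε * C := mul_le_mul_of_nonneg_right (min_le_left _ _) hC0
    simp only [Bool.false_eq_true, if_false]
    rw [abs_le] at *
    constructor <;> nlinarith

theorem exists_discreteApprox (ν : Measure ℝ) [IsProbabilityMeasure ν] {ε : ℝ} (hε : 0 < ε) :
    ∃ a V : ℝ, 0 < a ∧ (IsNormalizedDistribution ν → a = 1) ∧
      ∃ (κ : Type) (_ : Fintype κ) (p v : κ → ℝ), DiscreteApprox ν ε a V p v := by
  by_cases hν : IsNormalizedDistribution ν
  · obtain ⟨V, h⟩ := exists_discreteApprox_of_isNormalized hν hε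
    exact ⟨1, V, one_pos, fun _ => rfl, h⟩
  · obtain ⟨a, V, κ, hκ, p, v, ha, h⟩ := exists_discreteApprox_of_measure ν hε
    exact ⟨a, V, ha, fun h => absurd h hν, κ, hκ, p, v, h⟩

end Discretization

/-! ### Functions with finitely many values. -/

section FiniteRange

theorem finite_range_add {X : Type*} {f g : X → ℝ} (hf : (Set.range f).Finite)
    (hg : (Set.range g).Finite) : (Set.range fun x => f x + g x).Finite :=
  (hf.image2 (fun a b => a + b) hg).subset
    (Set.range_subset_iff.2 fun x => ⟨f x, ⟨x, rfl⟩, g x, ⟨x, rfl⟩, rfl⟩)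

theorem finite_range_comp {X κ β : Type*} {f : X → κ} (hf : (Set.range f).Finite) (F : κ → β) :
    (Set.range fun x => F (f x)).Finite :=
  (hf.image F).subset (Set.range_subset_iff.2 fun x => ⟨f x, ⟨x, rfl⟩, rfl⟩)

theorem finite_range_ergAvg {d : ℕ} {X : Type*} [AddAction (Fin d → ℤ) X] {f : X → ℝ}
    (hf : (Set.range f).Finite) (n : ℕ) : (Set.range (ergAvg d n f)).Finite := by
  have h : ∀ S : Finset (Fin d → ℤ), (Set.range fun x => ∑ z ∈ S, f (z +ᵥ x)).Finite := by
    classical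
    intro S
    induction S using Finset.induction_on with
    | empty => simpa using Set.finite_range_const
    | insert a S ha ih =>
      simp only [Finset.sum_insert ha]
      exact finite_range_add (hf.subset (Set.range_subset_iff.2 fun x => ⟨a +ᵥ x, rfl⟩)) ih
  exact finite_range_comp (h _) fun t => ((n : ℝ) ^ d)⁻¹ * t

theorem exists_bound_of_finite_range {X : Type*} {f : X → ℝ} (hf : (Set.range f).Finite) :
    ∃ C, ∀ x, |f x| ≤ C := by
  obtain ⟨C, hC⟩ := (hf.image abs).bddAbove
  exact ⟨C, fun x => hC ⟨f x, ⟨x, rfl⟩, rfl⟩⟩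

end FiniteRange

/-! ### Almost invariant labels and their independence. -/

section LabelDisplacement

variable {d : ℕ} {X : Type*} [MeasurableSpace X] {μ : Measure X} [IsProbabilityMeasure μ]
  [AddAction (Fin d → ℤ) X] [MeasurableConstVAdd (Fin d → ℤ) X] {κ : Type*} [Fintype κ] {s : X → κ}

theorem integral_abs_label_displacement_le (hs : ∀ T : Set κ, MeasurableSet (s ⁻¹' T))
    {F : κ → ℝ} {C δ : ℝ} (hC0 : 0 ≤ C) (hC : ∀ j, |F j| ≤ C) {z : Fin d → ℤ}
    (hz : μ.real {x | s (z +ᵥ x) ≠ s x} ≤ δ) :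
    ∫ x, |F (s (z +ᵥ x)) - F (s x)| ∂μ ≤ 2 * C * δ := by
  have hm : MeasurableSet {x | s (z +ᵥ x) ≠ s x} := by
    have : {x | s (z +ᵥ x) ≠ s x} = (⋃ j, {x | s (z +ᵥ x) = j} ∩ {x | s x = j})ᶜ := by
      ext x; simp [eq_comm]
    rw [this]
    exact (MeasurableSet.iUnion fun j => ((measurable_const_vadd z)
      (measurableSet_fiber hs j)).inter (measurableSet_fiber hs j)).compl
  refine (integral_abs_le_of_support (C := 2 * C) (fun x => ?_) hm fun x hx => ?_).trans
    (mul_le_mul_of_nonneg_left hz (by positivity))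
  · refine (abs_sub _ _).trans ?_
    linarith [hC (s (z +ᵥ x)), hC (s x)]
  · have : s (z +ᵥ x) = s x := by simpa using hx
    rw [this, sub_self]

variable [VAddInvariantMeasure (Fin d → ℤ) X μ]

/-- An almost invariant label is almost independent of a finite-valued function whose level sets
have almost constant ergodic averages. -/
theorem abs_integral_pair_sub_le (hs : ∀ T : Set κ, MeasurableSet (s ⁻¹' T))
    {F : κ → ℝ → ℝ} {C δ η : ℝ} (hC0 : 0 ≤ C) (hC : ∀ j b, |F j b| ≤ C) {w : X → ℝ}
    (hw : Measurable w) {W : Finset ℝ} (hW : ∀ x, w x ∈ W) {n : ℕ} (hn : 1 ≤ n)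
    (hδ : ∀ z ∈ cubeQ d n, μ.real {x | s (z +ᵥ x) ≠ s x} ≤ δ)
    (hη : ∀ b ∈ W, normOne μ (fun x => ergAvg d n ({y | w y = b}.indicator 1) x -
      ∫ y, {y | w y = b}.indicator 1 y ∂μ) ≤ η) :
    |∫ x, F (s x) (w x) ∂μ - ∫ p, F (s p.1) (w p.2) ∂(μ.prod μ)| ≤
      W.card * (2 * C * δ + C * η) := by
  let ψ : ℝ → X → ℝ := fun b => {y | w y = b}.indicator 1
  have hψm : ∀ b, Measurable (ψ b) := fun b =>
    measurable_one.indicator (hw (measurableSet_singleton b))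
  have hψ1 : ∀ b x, |ψ b x| ≤ 1 := by
    intro b x
    by_cases h : x ∈ {y | w y = b} <;> simp [ψ, h]
  have hFm : ∀ b, Measurable fun x => F (s x) b := fun b => measurable_comp_label hs fun j => F j b
  have hFi : ∀ b, Integrable (fun x => F (s x) b) μ := fun b =>
    integrable_of_abs_le (hFm b) fun x => hC _ b
  have hdec : ∀ j x, F j (w x) = ∑ b ∈ W, F j b * ψ b x := by
    intro j x
    rw [Finset.sum_eq_single_of_mem (w x) (hW x)]
    · simp [ψ]
    · intro b _ hb
      simp [ψ, hb.symm]
  have h1 : ∫ x, F (s x) (w x) ∂μ = ∑ b ∈ W, ∫ x, F (s x) b * ψ b x ∂μ := by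
    simp_rw [hdec]
    refine integral_finsetSum _ fun b _ => integrable_of_abs_le (C := C) ((hFm b).mul (hψm b))
      fun x => ?_
    rw [abs_mul]
    exact (mul_le_mul (hC _ b) (hψ1 b x) (abs_nonneg _) hC0).trans_eq (mul_one C)
  have h2 : ∫ p, F (s p.1) (w p.2) ∂(μ.prod μ) =
      ∑ b ∈ W, (∫ x, F (s x) b ∂μ) * ∫ x, ψ b x ∂μ := by
    simp_rw [hdec]
    rw [integral_finsetSum _ fun b _ =>
      (hFi b).mul_prod (integrable_of_abs_le (hψm b) (hψ1 b))]
    exact Finset.sum_congr rfl fun b _ => integral_prod_mul (fun x => F (s x) b) (ψ b)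
  rw [h1, h2, ← Finset.sum_sub_distrib]
  refine (Finset.abs_sum_le_sum_abs _ _).trans ((Finset.sum_le_sum fun b hb => ?_).trans_eq
    (by rw [Finset.sum_const, nsmul_eq_mul]))
  refine (abs_integral_mul_sub_le (hFm b) (hψm b) (fun x => hC _ b) (hψ1 b) hn fun z hz =>
    integral_abs_label_displacement_le hs hC0 (fun j => hC j b) (hδ z hz)).trans ?_
  have := mul_le_mul_of_nonneg_left (hη b hb) hC0
  linarith

end LabelDisplacement

/-! ### One step of the construction. -/

/-- The requirements on the scales `N ≤ R` and on the summand `h`, relative to the sum `u` of the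
earlier summands and the last scale `r` used. -/
structure ScaleStep (d : ℕ) {X : Type*} [MeasurableSpace X] [AddAction (Fin d → ℤ) X]
    (μ : Measure X) (ν : Measure ℝ) (ε' ε a V c : ℝ) (k : ℕ) (ρ : ℕ → ℝ) (u : X → ℝ) (r : ℕ)
    (N R : ℕ) (h : X → ℝ) : Prop where
  one_le : 1 ≤ N
  le : N ≤ R
  lt : r < N
  mul_r_le : (k + 1) * r ≤ N
  mul_N_le : (k + 1) * N ≤ R
  growth : ρ N ≤ (R : ℝ) / N
  past : ∀ n, N ≤ n → normOne μ (ergAvg d n u) ≤ ε * c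
  inv : ∀ n ∈ Set.Icc N R, normOne μ (fun x => ergAvg d n h x - h x) ≤ ε
  meas : Measurable h
  fin : (Set.range h).Finite
  bound : ∀ x, |h x| ≤ V + ε
  mean : ∫ x, h x ∂μ = 0
  norm : |normOne μ h - a| ≤ 2 * ε
  dist : ∀ g : ℝ → ℝ, Measurable g → ∀ C e L : ℝ, 0 ≤ L → (∀ t, |g t| ≤ C) →
    (∀ s t, |g s - g t| ≤ e + L * |s - t|) →
    |∫ x, g (h x) ∂μ - ∫ t, g t ∂ν| ≤ 2 * e + 2 * L * ε' + 5 * C * ε'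
  indep : ∀ m ≤ r, ∀ (G : ℝ → ℝ → ℝ) (C : ℝ), (∀ s t, |G s t| ≤ C) →
    |∫ x, G (h x) (ergAvg d m u x) ∂μ - ∫ p, G (h p.1) (ergAvg d m u p.2) ∂(μ.prod μ)| ≤ C * ε

section Step

variable {d : ℕ} {X : Type*} [MeasurableSpace X] [StandardBorelSpace X]
  {μ : Measure X} [IsProbabilityMeasure μ] [AddAction (Fin d → ℤ) X]
  [MeasurableConstVAdd (Fin d → ℤ) X] [ErgodicVAdd (Fin d → ℤ) X μ]

/-- Lower bounds suffice: both weights sum to `1`, so any excess is paid for by deficits of at most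
`δ`. -/
theorem sum_abs_sub_le {κ : Type*} [Fintype κ] {p q : κ → ℝ} {δ : ℝ} (hp : ∑ j, p j = 1)
    (hq : ∑ j, q j = 1) (h : ∀ j, p j - δ ≤ q j) :
    ∑ j, |q j - p j| ≤ 2 * Fintype.card κ * δ := by
  have hδ : 0 ≤ Fintype.card κ * δ := by
    have h1 := Finset.sum_le_sum fun j (_ : j ∈ Finset.univ) => h j
    rw [Finset.sum_sub_distrib, hp, hq] at h1
    simp at h1
    linarith
  have h1 : ∀ j ∈ Finset.univ, |q j - p j| ≤ (q j - p j) + 2 * max δ 0 := by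
    intro j _
    have := h j
    have := le_max_left δ 0
    have := le_max_right δ 0
    rw [abs_le]
    constructor <;> linarith
  refine (Finset.sum_le_sum h1).trans ?_
  rw [Finset.sum_add_distrib, Finset.sum_sub_distrib, hp, hq]
  simp only [Finset.sum_const, Finset.card_univ, nsmul_eq_mul, sub_self, zero_add]
  rcases le_total 0 δ with h0 | h0
  · rw [max_eq_left h0]; linarith
  · rw [max_eq_right h0]; linarith

/-- The order of choices is what matters: `N` depends only on the past `u`, `R` only on `N`, and the
label, hence `h`, comes last, so its invariance along `Q_R` can be prescribed. -/
theorem exists_scaleStep (hd : 1 ≤ d) (hfree : ∀ z : Fin d → ℤ, z ≠ 0 → ∀ᵐ x ∂μ, z +ᵥ x ≠ x)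
    {ν : Measure ℝ} {ε' ε a V c : ℝ} (hε : 0 < ε) (hεε' : ε ≤ ε') (hc : 0 < c) {κ : Type} [Fintype κ] {p v : κ → ℝ}
    (hpv : DiscreteApprox ν ε' a V p v) (k : ℕ) (ρ : ℕ → ℝ) {u : X → ℝ} (hu : Measurable u)
    (hufin : (Set.range u).Finite) (hu0 : ∫ x, u x ∂μ = 0) (r : ℕ) :
    ∃ (N R : ℕ) (h : X → ℝ), ScaleStep d μ ν ε' ε a V c k ρ u r N R h := by
  classical
  obtain ⟨hp0, hp1, hpv0, hpva, hvV, hdist⟩ := hpv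
  -- the values of the averages of `u`
  have hWfin : (⋃ m ∈ Finset.range (r + 1), Set.range (ergAvg d m u)).Finite :=
    (Finset.range (r + 1)).finite_toSet.biUnion fun m _ => finite_range_ergAvg hufin m
  set W : Finset ℝ := hWfin.toFinset with hWdef
  have hW : ∀ m ≤ r, ∀ x, ergAvg d m u x ∈ W := by
    intro m hm x
    rw [hWdef, Set.Finite.mem_toFinset]
    exact Set.mem_biUnion (Finset.mem_coe.2 (Finset.mem_range.2 (Nat.lt_succ_of_le hm))) ⟨x, rfl⟩
  set η : ℝ := ε / (2 * (W.card + 1)) with hη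
  have hη0 : 0 < η := by positivity
  obtain ⟨B, hB⟩ := exists_bound_of_finite_range hufin
  -- the scales
  have hev1 : ∀ᶠ n in atTop, normOne μ (ergAvg d n u) < ε * c := by
    have := tendsto_normOne_ergAvg (d := d) (μ := μ) hu hB
    simp only [hu0, sub_zero] at this
    exact this.eventually_lt_const (by positivity)
  have hev2 : ∀ᶠ n in atTop, ∀ m ∈ Finset.range (r + 1), ∀ b ∈ W,
      normOne μ (fun x => ergAvg d n ({y | ergAvg d m u y = b}.indicator 1) x -
      ∫ y, {y | ergAvg d m u y = b}.indicator 1 y ∂μ) < η := by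
    refine (Finset.eventually_all _).2 fun m _ => (Finset.eventually_all _).2 fun b _ => ?_
    have h1 : ∀ x, |{y | ergAvg d m u y = b}.indicator (1 : X → ℝ) x| ≤ 1 := by
      intro x
      by_cases h : x ∈ {y | ergAvg d m u y = b} <;> simp [h]
    exact (tendsto_normOne_ergAvg (measurable_one.indicator
      (measurable_ergAvg hu m (measurableSet_singleton b))) h1).eventually_lt_const hη0
  -- This lower bound gives both `r < N` and `(k + 1) * r ≤ N`.
  obtain ⟨N, ⟨hN1, hN2⟩, hN3⟩ := (((eventually_forall_ge_atTop.2 hev1).and hev2).and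
    (eventually_ge_atTop ((k + 1) * r + r + 1))).exists
  have hN0 : 1 ≤ N := by omega
  set R : ℕ := max ((k + 1) * N) ⌈ρ N * N⌉₊ with hR
  have hkN : (k + 1) * N ≤ R := le_max_left _ _
  have hNR : N ≤ R := le_trans (by nlinarith) hkN
  -- the label
  set T : ℝ := 2 * (Fintype.card κ + 1) * (|V| + 1) with hT
  have hT0 : 0 < T := by positivity
  -- The first bound serves independence. The second makes the displacement and the total variation
  -- error at most `ε`, even after multiplication by `|V|`.
  set δ : ℝ := min (η / 2) (ε / T) with hδ
  have hδ0 : 0 < δ := by positivity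
  have hTδ : T * δ ≤ ε := by
    have : δ ≤ ε / T := min_le_right _ _
    rw [le_div_iff₀ hT0] at this
    linarith
  have hVδ : 0 ≤ |V| * δ := by positivity
  have hcV : 0 ≤ Fintype.card κ * (|V| * δ) := by positivity
  have hcδ : 0 ≤ Fintype.card κ * δ := by positivity
  have hTexp : T * δ = 2 * (Fintype.card κ * (|V| * δ)) + 2 * (Fintype.card κ * δ) +
      2 * (|V| * δ) + 2 * δ := by rw [hT]; ring
  obtain ⟨s, hs, hsinv, hsp⟩ := exists_almost_invariant_labelling hd hfree hp0 hp1 R hδ0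
  have htv := sum_abs_sub_le hp1 (sum_measureReal_fibers (μ := μ) hs) hsp
  have hcmp : ∀ (F : κ → ℝ) (C : ℝ), (∀ j, |F j| ≤ C) →
      |∫ x, F (s x) ∂μ - ∑ j, p j * F j| ≤ C * (2 * Fintype.card κ * δ) := by
    intro F C hC
    rw [integral_comp_label hs, ← Finset.sum_sub_distrib]
    have hC0 : 0 ≤ C ∨ IsEmpty κ := by
      by_cases h : Nonempty κ
      · exact Or.inl ((abs_nonneg _).trans (hC h.some))
      · exact Or.inr (not_nonempty_iff.1 h)
    rcases hC0 with hC0 | h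
    · refine (Finset.abs_sum_le_sum_abs _ _).trans (le_trans ?_ (mul_le_mul_of_nonneg_left htv hC0))
      rw [Finset.mul_sum]
      refine Finset.sum_le_sum fun j _ => ?_
      rw [← sub_mul, abs_mul, mul_comm]
      exact mul_le_mul_of_nonneg_right (hC j) (abs_nonneg _)
    · simp at hp1
  have hvV' : ∀ j, |v j| ≤ |V| := fun j => (hvV j).trans (le_abs_self V)
  -- The label measures are only close to `p`, so `v ∘ s` may have a small mean; subtracting it
  -- makes the mean of `h` exactly zero.
  set M : ℝ := ∫ x, v (s x) ∂μ with hM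
  have hMε : |M| ≤ ε := by
    have := hcmp v |V| hvV'
    rw [hpv0, sub_zero] at this
    linarith
  have hvm : Measurable fun x => v (s x) := measurable_comp_label hs v
  have hvi : Integrable (fun x => v (s x)) μ := integrable_of_abs_le hvm fun x => hvV' (s x)
  have hhm : Measurable fun x => v (s x) - M := hvm.sub_const M
  have hhi : Integrable (fun x => v (s x) - M) μ := hvi.sub (integrable_const M)
  refine ⟨N, R, fun x => v (s x) - M, ?_⟩
  constructor
  · exact hN0
  · exact hNR
  · nlinarith
  · nlinarith
  · exact hkN
  · rw [le_div_iff₀ (by positivity)]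
    exact (Nat.le_ceil _).trans (by exact_mod_cast le_max_right _ _)
  · exact fun n hn => (hN1 n hn).le
  · intro n hn
    refine normOne_ergAvg_sub_le hhi (hN0.trans hn.1) fun z hz => ?_
    simp only [sub_sub_sub_cancel_right]
    refine (integral_abs_label_displacement_le hs (abs_nonneg V) hvV'
      (hsinv z (cubeQ_mono hn.2 hz))).trans ?_
    linarith
  · exact hhm
  · exact finite_range_comp (Set.toFinite (Set.range s)) fun j => v j - M
  · intro x
    exact (abs_sub _ _).trans (add_le_add (hvV _) hMε)
  · rw [integral_sub hvi (integrable_const M)]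
    simp [hM]
  · have h1 := hcmp (fun j => |v j|) |V| fun j => by simpa using hvV' j
    rw [hpva] at h1
    have h2 : |normOne μ (fun x => v (s x) - M) - ∫ x, |v (s x)| ∂μ| ≤ ε := by
      have hha : Integrable (fun x => |v (s x) - M|) μ := hhi.abs
      unfold normOne
      rw [← integral_sub hha hvi.abs]
      refine abs_integral_le_integral_abs.trans ?_
      refine normOne_le_of_abs_le (f := fun x => |v (s x) - M| - |v (s x)|) fun x => ?_
      refine (abs_abs_sub_abs_le _ _).trans ?_
      simpa using hMε
    have h3 := abs_sub_le (normOne μ (fun x => v (s x) - M)) (∫ x, |v (s x)| ∂μ) a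
    linarith
  · intro g hg C e L hL hC hgL
    have hC0 : 0 ≤ C := (abs_nonneg _).trans (hC 0)
    have h1 := hcmp (fun j => g (v j)) C fun j => hC _
    have h2 := hdist g hg C e L hL hC hgL
    have h3 : |∫ x, g (v (s x) - M) ∂μ - ∫ x, g (v (s x)) ∂μ| ≤ e + L * ε := by
      have hi1 : Integrable (fun x => g (v (s x) - M)) μ :=
        integrable_of_abs_le (hg.comp hhm) fun x => hC _
      have hi2 : Integrable (fun x => g (v (s x))) μ :=
        integrable_of_abs_le (hg.comp hvm) fun x => hC _
      rw [← integral_sub hi1 hi2]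
      refine abs_integral_le_integral_abs.trans ?_
      refine normOne_le_of_abs_le (f := fun x => g (v (s x) - M) - g (v (s x))) fun x => ?_
      refine (hgL _ _).trans ?_
      gcongr
      simpa using hMε
    have h4 : C * (2 * Fintype.card κ * δ) ≤ C * ε := by
      refine mul_le_mul_of_nonneg_left ?_ hC0
      linarith
    have h5 : L * ε ≤ L * ε' := by gcongr
    have h6 : C * ε ≤ C * ε' := by gcongr
    rw [abs_le] at *
    constructor <;> linarith
  · intro m hm G C hC
    have hC0 : 0 ≤ C := (abs_nonneg _).trans (hC 0 0)
    have h1 := abs_integral_pair_sub_le (d := d) (μ := μ) hs (F := fun j t => G (v j - M) t) hC0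
      (fun j b => hC _ b) (measurable_ergAvg hu m) (hW m hm) hN0
      (fun z hz => hsinv z (cubeQ_mono hNR hz))
      (fun b hb => (hN2 m (Finset.mem_range.2 (Nat.lt_succ_of_le hm)) b hb).le)
    refine h1.trans ?_
    have h2 : 2 * C * δ + C * η ≤ C * (2 * η) := by
      have : δ ≤ η / 2 := min_le_left _ _
      nlinarith
    have h3 : (W.card : ℝ) * (2 * η) ≤ ε := by
      rw [hη]
      have : (W.card : ℝ) * (2 * (ε / (2 * (W.card + 1)))) = ε * (W.card / (W.card + 1)) := by
        field_simp
      rw [this]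
      refine mul_le_of_le_one_right hε.le ?_
      rw [div_le_one (by positivity)]
      linarith
    calc (W.card : ℝ) * (2 * C * δ + C * η) ≤ W.card * (C * (2 * η)) := by gcongr
      _ = C * (W.card * (2 * η)) := by ring
      _ ≤ C * ε := mul_le_mul_of_nonneg_left h3 hC0

end Step

/-! ### The recursion and the limit of the partial sums. -/

section Sequence

variable {d : ℕ} {X : Type*} [MeasurableSpace X] [StandardBorelSpace X]
  {μ : Measure X} [IsProbabilityMeasure μ] [AddAction (Fin d → ℤ) X]
  [MeasurableConstVAdd (Fin d → ℤ) X] [ErgodicVAdd (Fin d → ℤ) X μ]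

/-- The summands and scales constructed recursively. -/
theorem exists_scaleStep_sequence (hd : 1 ≤ d)
    (hfree : ∀ z : Fin d → ℤ, z ≠ 0 → ∀ᵐ x ∂μ, z +ᵥ x ≠ x)
    {ν : ℕ → Measure ℝ} {ε' ε a V c : ℕ → ℝ} (hε : ∀ k, 0 < ε k)
    (hεε' : ∀ k, ε k ≤ ε' k) (hc : ∀ k, 0 < c k)
    (hpv : ∀ k, ∃ (κ : Type) (_ : Fintype κ) (p v : κ → ℝ),
      DiscreteApprox (ν k) (ε' k) (a k) (V k) p v) (ρ : ℕ → ℕ → ℝ) :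
    ∃ (N R r : ℕ → ℕ) (h u : ℕ → X → ℝ),
      (∀ k, ScaleStep d μ (ν k) (ε' k) (ε k) (a k) (V k) (c k) k (ρ k) (u k) (r k) (N k) (R k) (h k)) ∧
      (∀ k, r (k + 1) = R k) ∧ (∀ k, Measurable (u k)) ∧ (∀ k, ∫ x, u k x ∂μ = 0) ∧
      (∀ x, u 0 x = 0) ∧ ∀ k x, u (k + 1) x = u k x + c k * h k x := by
  -- The state of the recursion: the partial sum with the properties needed for the next step, and
  -- the last scale used.
  let S := {u : X → ℝ // Measurable u ∧ (Set.range u).Finite ∧ ∫ x, u x ∂μ = 0} × ℕ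
  have hstep : ∀ (k : ℕ) (σ : S), ∃ (N R : ℕ) (h : X → ℝ),
      ScaleStep d μ (ν k) (ε' k) (ε k) (a k) (V k) (c k) k (ρ k) σ.1.1 σ.2 N R h := by
    intro k σ
    obtain ⟨κ, _, p, v, H⟩ := hpv k
    exact exists_scaleStep hd hfree (hε k) (hεε' k) (hc k) H k (ρ k) σ.1.2.1 σ.1.2.2.1 σ.1.2.2.2 σ.2
  choose N R h H using hstep
  have hnext : ∀ (k : ℕ) (σ : S), Measurable (fun x => σ.1.1 x + c k * h k σ x) ∧
      (Set.range fun x => σ.1.1 x + c k * h k σ x).Finite ∧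
      ∫ x, σ.1.1 x + c k * h k σ x ∂μ = 0 := by
    intro k σ
    obtain ⟨B, hB⟩ := exists_bound_of_finite_range σ.1.2.2.1
    refine ⟨σ.1.2.1.add ((H k σ).meas.const_mul _), finite_range_add σ.1.2.2.1
      (finite_range_comp (H k σ).fin fun t => c k * t), ?_⟩
    rw [integral_add (integrable_of_abs_le σ.1.2.1 hB)
      ((integrable_of_abs_le (H k σ).meas (H k σ).bound).const_mul _), σ.1.2.2.2,
      integral_const_mul, (H k σ).mean, mul_zero, add_zero]
  let s0 : S := (⟨fun _ => 0, measurable_const, Set.finite_range_const, by simp⟩, 0)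
  let s : ℕ → S := fun k => Nat.rec s0 (fun k σ => (⟨_, hnext k σ⟩, R k σ)) k
  exact ⟨fun k => N k (s k), fun k => R k (s k), fun k => (s k).2, fun k => h k (s k),
    fun k => (s k).1.1, fun k => H k (s k), fun k => rfl, fun k => (s k).1.2.1,
    fun k => (s k).1.2.2.2, fun x => rfl, fun k x => rfl⟩

end Sequence

/-- Partial sums whose increments are controlled by a rapidly decreasing sequence converge. -/
theorem exists_limit_of_increments {X : Type*} {u : ℕ → X → ℝ} {t : ℕ → ℝ} (ht0 : ∀ k, 0 ≤ t k)
    (ht : ∀ k, t (k + 1) ≤ t k / 2)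
    (hu : ∀ k x, |u (k + 2) x - u (k + 1) x| ≤ t k / 2) :
    ∃ f : X → ℝ, (∀ x, Tendsto (fun k => u (k + 1) x) atTop (𝓝 (f x))) ∧
      (∀ k x, |f x - u (k + 1) x| ≤ t k) ∧ Tendsto t atTop (𝓝 0) := by
  have hgeo : ∀ k, t k ≤ t 0 * (1 / 2) ^ k := by
    intro k
    induction k with
    | zero => simp
    | succ k ih => rw [pow_succ]; linarith [ht k]
  have hlim : Tendsto t atTop (𝓝 0) := by
    refine squeeze_zero ht0 hgeo ?_
    simpa using (tendsto_pow_atTop_nhds_zero_of_lt_one (r := (1 / 2 : ℝ)) (by norm_num)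
      (by norm_num)).const_mul (t 0)
  -- Since `t k / 2 ≤ t k - t (k + 1)`, the bounds on the increments telescope.
  have hdiff : ∀ k m x, |u (k + m + 1) x - u (k + 1) x| ≤ t k - t (k + m) := by
    intro k m x
    induction m with
    | zero => simp
    | succ m ih =>
      have h1 := hu (k + m) x
      have h2 := ht (k + m)
      have h3 := abs_sub_le (u (k + m + 2) x) (u (k + m + 1) x) (u (k + 1) x)
      rw [show k + (m + 1) + 1 = k + m + 2 by ring, show k + (m + 1) = k + m + 1 by ring]
      linarith
  have hdiff' : ∀ k n x, k ≤ n → |u (n + 1) x - u (k + 1) x| ≤ t k := by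
    intro k n x hkn
    obtain ⟨m, rfl⟩ := Nat.exists_eq_add_of_le hkn
    linarith [hdiff k m x, ht0 (k + m)]
  have hex : ∀ x, ∃ y, Tendsto (fun k => u (k + 1) x) atTop (𝓝 y) := fun x =>
    cauchySeq_tendsto_of_complete (cauchySeq_of_le_tendsto_0' t (fun k n hkn => by
      rw [dist_comm, Real.dist_eq]
      exact hdiff' k n x hkn) hlim)
  choose f hf using hex
  refine ⟨f, hf, fun k x => ?_, hlim⟩
  exact le_of_tendsto ((hf x).sub_const (u (k + 1) x)).abs
    (eventually_atTop.2 ⟨k, fun n hn => hdiff' k n x hn⟩)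

/-! ### Passing from the summands to the normalized averages. -/

section Comparison

theorem abs_integral_sub_integral_le {Ω : Type*} [MeasurableSpace Ω] {P : Measure Ω}
    [IsProbabilityMeasure P] {F G D : Ω → ℝ} (hF : Integrable F P) (hG : Integrable G P)
    (hD : Integrable D P) {e L B : ℝ} (hL : 0 ≤ L) (h : ∀ ω, |F ω - G ω| ≤ e + L * D ω)
    (hB : ∫ ω, D ω ∂P ≤ B) : |∫ ω, F ω ∂P - ∫ ω, G ω ∂P| ≤ e + L * B := by
  rw [← integral_sub hF hG]
  refine abs_integral_le_integral_abs.trans ?_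
  refine (integral_mono (hF.sub hG).abs ((integrable_const e).add (hD.const_mul L)) h).trans ?_
  have h1 : ∫ ω, (e + L * D ω) ∂P = e + L * ∫ ω, D ω ∂P := by
    rw [integral_add (integrable_const e) (hD.const_mul L), integral_const_mul]
    simp
  exact h1.trans_le (by gcongr)

/-- A function in `C₀` is Lipschitz up to a small error. -/
theorem ZeroAtInftyContinuousMap.exists_lipschitz_up_to {E : Type*} [PseudoMetricSpace E]
    (g : C₀(E, ℝ)) {e : ℝ} (he : 0 < e) :
    ∃ L, 0 ≤ L ∧ ∀ s t, |g s - g t| ≤ e + L * dist s t := by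
  obtain ⟨δ, hδ, h⟩ := Metric.uniformContinuous_iff.1
    (ZeroAtInftyContinuousMap.uniformContinuous g) e he
  obtain ⟨C, hC⟩ : ∃ C, ∀ t, |g t| ≤ C :=
    ⟨‖g.toBCF‖, fun t => g.toBCF.norm_coe_le_norm t⟩
  -- For points at distance at least `δ` this slope already dominates the oscillation `2 * |C|`.
  refine ⟨2 * |C| / δ, by positivity, fun s t => ?_⟩
  by_cases hst : dist s t < δ
  · have h1 := (h hst).le
    rw [Real.dist_eq] at h1
    have h2 : 0 ≤ 2 * |C| / δ * dist s t := by positivity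
    linarith
  · push Not at hst
    have h1 : |g s - g t| ≤ 2 * |C| := by
      refine (abs_sub _ _).trans ?_
      linarith [hC s, hC t, le_abs_self C]
    have h2 : 2 * |C| ≤ 2 * |C| / δ * dist s t := by
      rw [div_mul_eq_mul_div, le_div_iff₀ hδ]
      gcongr
    linarith

theorem ZeroAtInftyContinuousMap.exists_abs_le {E : Type*} [TopologicalSpace E] (g : C₀(E, ℝ)) :
    ∃ C, 0 ≤ C ∧ ∀ t, |g t| ≤ C :=
  ⟨‖g.toBCF‖, norm_nonneg _, fun t => g.toBCF.norm_coe_le_norm t⟩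

variable {X : Type*} [MeasurableSpace X] {μ : Measure X}

theorem valueDistribution_eq_map {Y : Type*} [MeasurableSpace Y] {g : X → Y} (hg : Measurable g) :
    valueDistribution μ g = μ.map g := by
  unfold valueDistribution
  rw [Measure.map_map measurable_snd (measurable_id'.prodMk hg)]
  rfl

theorem integral_valueDistribution {Y : Type*} [MeasurableSpace Y] {F : X → Y} (hF : Measurable F)
    {g : Y → ℝ} (hg : Measurable g) : ∫ y, g y ∂(valueDistribution μ F) = ∫ x, g (F x) ∂μ := by
  rw [valueDistribution_eq_map hF, integral_map hF.aemeasurable hg.aestronglyMeasurable]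

theorem integral_prod_valueDistribution [SFinite μ] {F G : X → ℝ} (hF : Measurable F)
    (hG : Measurable G) {g : ℝ × ℝ → ℝ} (hg : Measurable g) :
    ∫ p, g p ∂((valueDistribution μ F).prod (valueDistribution μ G)) =
      ∫ p, g (F p.1, G p.2) ∂(μ.prod μ) := by
  rw [valueDistribution_eq_map hF, valueDistribution_eq_map hG, Measure.map_prod_map _ _ hF hG,
    integral_map (hF.prodMap hG).aemeasurable hg.aestronglyMeasurable]
  rfl

/-- If `A` is close to `c h` then `A / ‖A‖₁` is close to `h / ‖h‖₁`. -/
theorem normOne_normalized_sub_le {A h : X → ℝ} (hA : Integrable A μ) (hh : Integrable h μ)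
    {a c ε : ℝ} (hc : 0 < c) (hεa : 8 * ε ≤ a) (hε : 0 < ε)
    (hAh : normOne μ (fun x => A x - c * h x) ≤ 3 * (c * ε)) (hha : |normOne μ h - a| ≤ 2 * ε) :
    c * a / 4 ≤ normOne μ A ∧
      normOne μ (fun x => a * (A x / normOne μ A) - h x) ≤ 8 * ε := by
  have h1 : normOne μ A ≤ normOne μ (fun x => A x - c * h x) + normOne μ (fun x => c * h x) := by
    have := normOne_add_le (f := fun x => A x - c * h x) (hA.sub (hh.const_mul c)) (hh.const_mul c)
    simpa using this
  have h2 : normOne μ (fun x => c * h x) ≤ normOne μ A + normOne μ (fun x => A x - c * h x) := by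
    have := normOne_add_le (f := fun x => c * h x - A x) ((hh.const_mul c).sub hA) hA
    rw [normOne_sub_comm] at this
    simp only [sub_add_cancel] at this
    linarith
  rw [normOne_smul, abs_of_pos hc] at h1 h2
  rw [abs_le] at hha
  -- The error `5 * ε` combines `3 * ε` from `A` and `2 * ε` from the norm of `h`; `8 * ε ≤ a` then
  -- bounds `‖A‖₁` away from zero.
  have h3 : c * (a - 5 * ε) ≤ normOne μ A := by nlinarith
  have h4 : normOne μ A ≤ c * (a + 5 * ε) := by nlinarith
  have h5 : c * a / 4 ≤ normOne μ A := by nlinarith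
  have hapos : 0 < a := by linarith
  have hApos : 0 < normOne μ A := lt_of_lt_of_le (by positivity) h5
  refine ⟨h5, ?_⟩
  have e : (fun x => a * (A x / normOne μ A) - h x) =
      fun x => (a / normOne μ A - c⁻¹) * A x + c⁻¹ * (A x - c * h x) := by
    funext x
    field_simp
    ring
  have hAhi : Integrable (fun x => A x - c * h x) μ := hA.sub (hh.const_mul c)
  rw [e]
  refine (normOne_add_le (hA.const_mul _) (hAhi.const_mul _)).trans ?_
  rw [normOne_smul, normOne_smul, abs_of_pos (inv_pos.2 hc)]
  have h6 : |a / normOne μ A - c⁻¹| * normOne μ A ≤ 5 * ε := by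
    rw [← abs_of_pos hApos, ← abs_mul, abs_of_pos hApos, sub_mul, div_mul_cancel₀ _ hApos.ne',
      abs_le]
    have h7 : c⁻¹ * normOne μ A ≤ a + 5 * ε := by rwa [inv_mul_le_iff₀ hc]
    have h8 : a - 5 * ε ≤ c⁻¹ * normOne μ A := by rwa [le_inv_mul_iff₀ hc]
    constructor <;> linarith
  have h9 : c⁻¹ * normOne μ (fun x => A x - c * h x) ≤ 3 * ε := by
    rw [inv_mul_le_iff₀ hc]
    linarith
  linarith

/-- Asymptotic independence passes from `h` and `w` to nearby functions `F` and `G`. -/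
theorem abs_integral_pair_sub_le_of_approx [IsProbabilityMeasure μ] {F G h w : X → ℝ}
    (hF : Measurable F) (hFi : Integrable F μ) (hG : Measurable G) (hh : Measurable h)
    (hhi : Integrable h μ) (hw : Measurable w) {b b' : ℝ} (hFh : normOne μ (fun x => F x - h x) ≤ b)
    (hGw : ∀ x, |G x - w x| ≤ b') {g : ℝ × ℝ → ℝ} (hg : Measurable g) {C e L I : ℝ}
    (hC : ∀ t, |g t| ≤ C) (hL : 0 ≤ L) (hgL : ∀ s t, |g s - g t| ≤ e + L * dist s t)
    (hind : |∫ x, g (h x, w x) ∂μ - ∫ p, g (h p.1, w p.2) ∂(μ.prod μ)| ≤ I) :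
    |∫ x, g (F x, G x) ∂μ - ∫ p, g (F p.1, G p.2) ∂(μ.prod μ)| ≤ 2 * (e + L * (b + b')) + I := by
  have hFhi : Integrable (fun x => |F x - h x|) μ := (hFi.sub hhi).abs
  have hDi : Integrable (fun x => |F x - h x| + b') μ := hFhi.add (integrable_const b')
  have hDB : ∫ x, |F x - h x| + b' ∂μ ≤ b + b' := by
    rw [integral_add hFhi (integrable_const b')]
    simpa [normOne] using hFh
  have hDB2 : ∫ p, |F p.1 - h p.1| + b' ∂(μ.prod μ) ≤ b + b' := by
    rw [integral_fun_fst (fun x => |F x - h x| + b')]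
    simpa using hDB
  have hdist : ∀ x y, |g (F x, G y) - g (h x, w y)| ≤ e + L * (|F x - h x| + b') := by
    intro x y
    refine (hgL _ _).trans ?_
    gcongr
    rw [Prod.dist_eq, Real.dist_eq, Real.dist_eq]
    refine max_le ?_ ?_
    · linarith [abs_nonneg (G y - w y), hGw y]
    · linarith [abs_nonneg (F x - h x), hGw y]
  have h1 := abs_integral_sub_integral_le (P := μ)
    (integrable_of_abs_le (hg.comp (hF.prodMk hG)) fun x => hC _)
    (integrable_of_abs_le (hg.comp (hh.prodMk hw)) fun x => hC _) hDi hL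
    (fun x => hdist x x) hDB
  have h2 := abs_integral_sub_integral_le (P := μ.prod μ)
    (integrable_of_abs_le (hg.comp ((hF.comp measurable_fst).prodMk (hG.comp measurable_snd)))
      fun p => hC _)
    (integrable_of_abs_le (hg.comp ((hh.comp measurable_fst).prodMk (hw.comp measurable_snd)))
      fun p => hC _) (hDi.comp_fst μ) hL (fun p => hdist p.1 p.2) hDB2
  simp only [Function.comp_apply] at h1 h2
  rw [abs_le] at *
  constructor <;> linarith

end Comparison

/-! ### The main theorem. -/

theorem mainTheorem3 {d : ℕ} (hd : 1 ≤ d) {X : Type*} [MeasurableSpace X] [StandardBorelSpace X]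
    (μ : Measure X) [IsProbabilityMeasure μ]
    [AddAction (Fin d → ℤ) X] [MeasurableConstVAdd (Fin d → ℤ) X]
    -- the action preserves the measure and is ergodic
    [ErgodicVAdd (Fin d → ℤ) X μ]
    -- the action is free
    (hfree : ∀ z : Fin d → ℤ, z ≠ 0 → ∀ᵐ x ∂μ, z +ᵥ x ≠ x)
    -- the prescribed distributions and the prescribed growth of `R k / N k`
    (ν : ℕ → Measure ℝ) [∀ k, IsProbabilityMeasure (ν k)] (ρ : ℕ → ℕ → ℝ) :
    ∃ (f : X → ℝ) (N R : ℕ → ℕ) (a : ℕ → ℝ),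
      Measurable f ∧ Integrable f μ ∧ ∫ x, f x ∂μ = 0 ∧
      -- the intervals of scales
      (∀ k, 1 ≤ N k ∧ N k ≤ R k ∧ R k < N (k + 1)) ∧
      (∀ k, ρ k (N k) ≤ (R k : ℝ) / (N k : ℝ)) ∧
      Tendsto (fun k => (R k : ℝ) / (N k : ℝ)) atTop atTop ∧
      Tendsto (fun k => (N (k + 1) : ℝ) / (R k : ℝ)) atTop atTop ∧
      -- the scales on the value line; none is needed for a normalized distribution
      (∀ k, 0 < a k) ∧ (∀ k, IsNormalizedDistribution (ν k) → a k = 1) ∧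
      -- the normalized averages are well defined
      (∀ k, ∀ n ∈ Set.Icc (N k) (R k), 0 < normOne μ (ergAvg d n f)) ∧
      -- on each interval they differ little from each other
      (∀ ε : ℝ, 0 < ε → ∃ K : ℕ, ∀ k, K ≤ k →
        ∀ n ∈ Set.Icc (N k) (R k), ∀ m ∈ Set.Icc (N k) (R k),
          normOne μ (fun x => a k * normalizedAvg d μ n f x - a k * normalizedAvg d μ m f x) < ε) ∧
      -- their distributions of values are weak-* close to the prescribed ones
      (∀ g : C₀(ℝ, ℝ), ∀ ε : ℝ, 0 < ε → ∃ K : ℕ, ∀ k, K ≤ k →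
        ∀ n ∈ Set.Icc (N k) (R k),
          |∫ t, g t ∂(valueDistribution μ fun x => a k * normalizedAvg d μ n f x)
            - ∫ t, g t ∂(ν k)| < ε) ∧
      -- averages at different scales are asymptotically independent
      (∀ g : C₀(ℝ × ℝ, ℝ), ∀ ε : ℝ, 0 < ε → ∃ K : ℕ, ∀ k j, k ≠ j → K ≤ max k j →
        ∀ n ∈ Set.Icc (N k) (R k), ∀ m ∈ Set.Icc (N j) (R j),
          |∫ p, g p ∂(valueDistribution μ fun x =>
                (a k * normalizedAvg d μ n f x, a j * normalizedAvg d μ m f x))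
            - ∫ p, g p ∂((valueDistribution μ fun x => a k * normalizedAvg d μ n f x).prod
                (valueDistribution μ fun x => a j * normalizedAvg d μ m f x))| < ε) := by
  -- the discrete targets and the accuracies
  have hε'0 : ∀ k : ℕ, (0 : ℝ) < 1 / ((k : ℝ) + 1) := fun k => by positivity
  choose a V ha hnorm hD using fun k => exists_discreteApprox (ν k) (hε'0 k)
  let ε' : ℕ → ℝ := fun k => 1 / ((k : ℝ) + 1)
  -- Two accuracies are needed: `a k` arises from the discretization with accuracy `ε' k`, and the
  -- later errors must also be small relative to `a k`.
  let ε : ℕ → ℝ := fun k => min (ε' k) (a k / 8)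
  have hε : ∀ k, 0 < ε k := fun k => lt_min (hε'0 k) (by have := ha k; positivity)
  have hεε' : ∀ k, ε k ≤ ε' k := fun k => min_le_left _ _
  have hεa : ∀ k, 8 * ε k ≤ a k := fun k => by
    have : ε k ≤ a k / 8 := min_le_right _ _
    linarith
  have hε'anti : ∀ k, ε' (k + 1) ≤ ε' k := fun k => by
    simp only [ε']
    push_cast
    exact one_div_le_one_div_of_le (by positivity) (by linarith)
  have hε'1 : ∀ k, ε' k ≤ 1 := fun k => by
    simp only [ε']
    rw [div_le_one (by positivity)]
    have : (0 : ℝ) ≤ k := k.cast_nonneg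
    linarith
  have hε'lim : Tendsto ε' atTop (𝓝 0) := tendsto_one_div_add_atTop_nhds_zero_nat
  -- the coefficients
  let c : ℕ → ℝ := fun k => Nat.rec 1 (fun k ck => ck * ε k / (2 * (|V (k + 1)| + 1))) k
  have hcs : ∀ k, c (k + 1) = c k * ε k / (2 * (|V (k + 1)| + 1)) := fun k => rfl
  have hc : ∀ k, 0 < c k := by
    intro k
    induction k with
    | zero => exact one_pos
    | succ k ih => rw [hcs]; have := hε k; positivity
  have hcV : ∀ k, c (k + 1) * (|V (k + 1)| + 1) = c k * ε k / 2 := fun k => by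
    rw [hcs]
    field_simp
  have hct : ∀ k, c (k + 1) ≤ c k * ε k / 2 := fun k => by
    have h1 := mul_le_mul_of_nonneg_left
      (show (1 : ℝ) ≤ |V (k + 1)| + 1 by linarith [abs_nonneg (V (k + 1))]) (hc (k + 1)).le
    linarith [hcV k]
  have hcanti : Antitone c := antitone_nat_of_succ_le fun k => by
    have h1 := mul_le_mul_of_nonneg_left ((hεε' k).trans (hε'1 k)) (hc k).le
    linarith [hct k, hc k]
  obtain ⟨N, R, r, h, u, H, hr, hum, hu0, hu00, hus⟩ :=
    exists_scaleStep_sequence hd hfree hε hεε' hc hD ρ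
  -- the limit function
  obtain ⟨f, hflim, hfu, htlim⟩ := exists_limit_of_increments (u := u) (t := fun k => c k * ε k)
    (fun k => mul_nonneg (hc k).le (hε k).le)
    (fun k => by
      have h1 := mul_le_mul_of_nonneg_left ((hεε' (k + 1)).trans (hε'1 (k + 1))) (hc (k + 1)).le
      linarith [hct k])
    (fun k x => by
      rw [hus (k + 1) x, add_sub_cancel_left, abs_mul, abs_of_pos (hc (k + 1)), ← hcV]
      refine mul_le_mul_of_nonneg_left (((H (k + 1)).bound x).trans ?_) (hc (k + 1)).le
      linarith [le_abs_self (V (k + 1)), hεε' (k + 1), hε'1 (k + 1)])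
  have hfm : Measurable f :=
    measurable_of_tendsto_metrizable (fun k => hum (k + 1)) (tendsto_pi_nhds.2 hflim)
  obtain ⟨B, hB⟩ : ∃ B, ∀ x, |f x| ≤ B := by
    refine ⟨c 0 * ε 0 + c 0 * (V 0 + ε 0), fun x => ?_⟩
    have h1 := hfu 0 x
    have h2 := mul_le_mul_of_nonneg_left ((H 0).bound x) (hc 0).le
    rw [← abs_of_pos (hc 0), ← abs_mul, abs_of_pos (hc 0)] at h2
    have h3 : u (0 + 1) x = c 0 * h 0 x := by rw [hus 0 x, hu00, zero_add]
    rw [← h3] at h2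
    have h4 := abs_sub_abs_le_abs_sub (f x) (u (0 + 1) x)
    linarith
  have hfi : Integrable f μ := integrable_of_abs_le hfm hB
  have hui : ∀ k, Integrable (u (k + 1)) μ := fun k => by
    refine integrable_of_abs_le (C := B + c k * ε k) (hum _) fun x => ?_
    have h1 := abs_sub_abs_le_abs_sub (u (k + 1) x) (f x)
    rw [abs_sub_comm] at h1
    linarith [hfu k x, hB x]
  have hf0 : ∫ x, f x ∂μ = 0 := by
    have h1 : ∀ k, |∫ x, f x ∂μ| ≤ c k * ε k := by
      intro k
      rw [← sub_zero (∫ x, f x ∂μ), ← hu0 (k + 1), ← integral_sub hfi (hui k)]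
      exact abs_integral_le_integral_abs.trans
        (normOne_le_of_abs_le (f := fun x => f x - u (k + 1) x) (hfu k))
    exact abs_nonpos_iff.1 (ge_of_tendsto' htlim h1)
  have hPm : ∀ n, Measurable (ergAvg d n f) := measurable_ergAvg hfm
  have hPi : ∀ n, Integrable (ergAvg d n f) μ := fun n =>
    integrable_of_abs_le (hPm n) (abs_ergAvg_le hB n)
  have hhi : ∀ k, Integrable (h k) μ := fun k => integrable_of_abs_le (H k).meas (H k).bound
  -- the averages at the scale `k` are close to `c k * h k`
  have hclose : ∀ k, ∀ n ∈ Set.Icc (N k) (R k),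
      normOne μ (fun x => ergAvg d n f x - c k * h k x) ≤ 3 * (c k * ε k) := by
    intro k n hn
    -- Later terms, earlier terms and the failure of invariance of `h k` contribute at most `c k * ε
    -- k` each.
    have e : (fun x => ergAvg d n f x - c k * h k x) = fun x =>
        ergAvg d n (fun y => f y - u (k + 1) y) x +
          (ergAvg d n (u k) x + c k * (ergAvg d n (h k) x - h k x)) := by
      have e1 : u (k + 1) = fun x => u k x + c k * h k x := funext (hus k)
      rw [e1, ergAvg_sub, ergAvg_add, ergAvg_smul]
      funext x
      ring
    have huki : Integrable (u k) μ := by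
      cases k with
      | zero =>
        have e0 : u 0 = fun _ => 0 := funext hu00
        rw [e0]
        exact integrable_const 0
      | succ k => exact hui k
    have hmp : ∀ (v : X → ℝ), Integrable v μ → Integrable (ergAvg d n v) μ := fun v hv =>
      (integrable_finsetSum _ fun z _ =>
        (measurePreserving_vadd z μ).integrable_comp_of_integrable hv).const_mul _
    have i1 := hmp (fun y => f y - u (k + 1) y) (hfi.sub (hui k))
    have i2 := hmp (u k) huki
    have i3 : Integrable (fun x => ergAvg d n (h k) x - h k x) μ := (hmp (h k) (hhi k)).sub (hhi k)
    have b1 : normOne μ (ergAvg d n fun y => f y - u (k + 1) y) ≤ c k * ε k :=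
      normOne_le_of_abs_le (abs_ergAvg_le (hfu k) n)
    have b2 := (H k).past n hn.1
    have b3 := mul_le_mul_of_nonneg_left ((H k).inv n hn) (hc k).le
    rw [e]
    have i4 : Integrable (fun x => ergAvg d n (u k) x + c k * (ergAvg d n (h k) x - h k x)) μ :=
      i2.add (i3.const_mul (c k))
    refine (normOne_add_le i1 i4).trans ?_
    have b4 := normOne_add_le i2 (i3.const_mul (c k))
    rw [normOne_smul, abs_of_pos (hc k)] at b4
    linarith
  have hest := fun k n hn => normOne_normalized_sub_le (hPi n) (hhi k) (hc k) (hεa k) (hε k)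
    (hclose k n hn) (H k).norm
  have hFm : ∀ k n, Measurable fun x => a k * normalizedAvg d μ n f x := fun k n =>
    ((hPm n).div_const _).const_mul _
  have hFi : ∀ k n, Integrable (fun x => a k * normalizedAvg d μ n f x) μ := fun k n =>
    ((hPi n).div_const _).const_mul _
  have hpos : ∀ k, ∀ n ∈ Set.Icc (N k) (R k), 0 < normOne μ (ergAvg d n f) := fun k n hn =>
    lt_of_lt_of_le (by have := hc k; have := ha k; positivity) (hest k n hn).1
  have hNR : ∀ k, R k < N (k + 1) := fun k => by
    have := (H (k + 1)).lt
    rwa [hr] at this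
  have hRmono : Monotone R := monotone_nat_of_le_succ fun k => (hNR k).le.trans (H (k + 1)).le
  -- asymptotic independence of two scales, the later one in the first coordinate
  have hpair : ∀ g : ℝ × ℝ → ℝ, Measurable g → ∀ C e L : ℝ, 0 ≤ L → (∀ t, |g t| ≤ C) →
      (∀ s t, |g s - g t| ≤ e + L * dist s t) → ∀ i j, j ≤ i →
      ∀ n ∈ Set.Icc (N (i + 1)) (R (i + 1)), ∀ m ∈ Set.Icc (N j) (R j),
      |∫ x, g (a (i + 1) * normalizedAvg d μ n f x, a j * normalizedAvg d μ m f x) ∂μ -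
        ∫ p, g (a (i + 1) * normalizedAvg d μ n f p.1, a j * normalizedAvg d μ m f p.2)
          ∂(μ.prod μ)| ≤ 2 * e + (24 * L + C) * ε' i := by
    intro g hg C e L hL hC hgL i j hji n hn m hm
    have hC0 : 0 ≤ C := (abs_nonneg _).trans (hC 0)
    have hmr : m ≤ r (i + 1) := by
      rw [hr]
      exact hm.2.trans (hRmono hji)
    -- The factor `q` turns `P_m f` into `a j * F_m`; it is at most `4 / c j`, so the tail `c i * ε
    -- i ≤ c j * ε i` is magnified to at most `4 * ε i`.
    set q : ℝ := a j / normOne μ (ergAvg d m f) with hq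
    have hq0 : 0 < q := div_pos (ha j) (hpos j m hm)
    have hqc : q * c j ≤ 4 := by
      rw [hq, div_mul_eq_mul_div, div_le_iff₀ (hpos j m hm)]
      linarith [(hest j m hm).1]
    have hGw : ∀ x, |a j * normalizedAvg d μ m f x - q * ergAvg d m (u (i + 1)) x| ≤ 4 * ε i := by
      intro x
      have h1 : a j * normalizedAvg d μ m f x - q * ergAvg d m (u (i + 1)) x =
          q * ergAvg d m (fun y => f y - u (i + 1) y) x := by
        rw [ergAvg_sub, hq]
        unfold normalizedAvg
        ring
      rw [h1, abs_mul, abs_of_pos hq0]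
      have h2 := abs_ergAvg_le (d := d) (hfu i) m x
      calc q * |ergAvg d m (fun y => f y - u (i + 1) y) x| ≤ q * (c i * ε i) := by gcongr
        _ ≤ q * (c j * ε i) := by
          have := hcanti hji
          have := (hε i).le
          gcongr
        _ = q * c j * ε i := by ring
        _ ≤ 4 * ε i := mul_le_mul_of_nonneg_right hqc (hε i).le
    have h1 := abs_integral_pair_sub_le_of_approx (hFm (i + 1) n) (hFi (i + 1) n) (hFm j m)
      (H (i + 1)).meas (hhi (i + 1)) ((measurable_ergAvg (hum (i + 1)) m).const_mul q)
      (hest (i + 1) n hn).2 hGw hg hC hL hgL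
      ((H (i + 1)).indep m hmr (fun s t => g (s, q * t)) C fun s t => hC _)
    refine h1.trans ?_
    have h2 : ε (i + 1) ≤ ε' i := (hεε' _).trans (hε'anti i)
    have h3 := mul_le_mul_of_nonneg_left h2 hL
    have h4 := mul_le_mul_of_nonneg_left (hεε' i) hL
    have h5 := mul_le_mul_of_nonneg_left h2 hC0
    linarith
  have hsmall : ∀ (Q : ℝ) (η : ℝ), 0 < η → ∃ K, ∀ k, K ≤ k → Q * ε' k < η := fun Q η hη =>
    eventually_atTop.1 ((by simpa using hε'lim.const_mul Q :
      Tendsto (fun k => Q * ε' k) atTop (𝓝 0)).eventually_lt_const hη)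
  refine ⟨f, N, R, a, hfm, hfi, hf0, fun k => ⟨(H k).one_le, (H k).le, hNR k⟩,
    fun k => (H k).growth, ?_, ?_, ha, hnorm, hpos, ?_, ?_, ?_⟩
  · refine tendsto_atTop_mono (fun k => ?_) tendsto_natCast_atTop_atTop
    have h1 : (0 : ℝ) < N k := by exact_mod_cast (H k).one_le
    rw [le_div_iff₀ h1]
    have h2 : ((k : ℝ) + 1) * N k ≤ R k := by exact_mod_cast (H k).mul_N_le
    linarith
  · refine tendsto_atTop_mono (fun k => ?_) tendsto_natCast_atTop_atTop
    have h1 : (0 : ℝ) < R k := by exact_mod_cast (H k).one_le.trans (H k).le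
    rw [le_div_iff₀ h1]
    have h2 := (H (k + 1)).mul_r_le
    rw [hr] at h2
    have h3 : ((k : ℝ) + 1 + 1) * R k ≤ N (k + 1) := by exact_mod_cast h2
    linarith
  · intro η hη
    obtain ⟨K, hK⟩ := hsmall 16 η hη
    refine ⟨K, fun k hk n hn m hm => lt_of_le_of_lt ?_ (hK k hk)⟩
    have e : (fun x => a k * normalizedAvg d μ n f x - a k * normalizedAvg d μ m f x) = fun x =>
        (a k * normalizedAvg d μ n f x - h k x) + (h k x - a k * normalizedAvg d μ m f x) := by
      funext x
      ring
    rw [e]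
    have i1 : Integrable (fun x => a k * normalizedAvg d μ n f x - h k x) μ :=
      (hFi k n).sub (hhi k)
    have i2 : Integrable (fun x => h k x - a k * normalizedAvg d μ m f x) μ :=
      (hhi k).sub (hFi k m)
    refine (normOne_add_le i1 i2).trans ?_
    rw [normOne_sub_comm (h k)]
    have h1 := (hest k n hn).2
    have h2 := (hest k m hm).2
    have h3 := hεε' k
    unfold normalizedAvg
    linarith
  · intro g η hη
    obtain ⟨C, hC0, hC⟩ := g.exists_abs_le
    obtain ⟨L, hL, hgL⟩ := g.exists_lipschitz_up_to (show 0 < η / 8 by positivity)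
    have hgm : Measurable g := (map_continuous g).measurable
    obtain ⟨K, hK⟩ := hsmall (10 * L + 5 * C) (η / 2) (by positivity)
    refine ⟨K, fun k hk n hn => ?_⟩
    rw [integral_valueDistribution (hFm k n) hgm]
    have h1 := (H k).dist g hgm C (η / 8) L hL hC fun s t => hgL s t
    have h2 := abs_integral_sub_integral_le (P := μ) (F := fun x => g (a k * normalizedAvg d μ n f x))
      (G := fun x => g (h k x)) (D := fun x => |a k * normalizedAvg d μ n f x - h k x|)
      (integrable_of_abs_le (hgm.comp (hFm k n)) fun x => hC _)
      (integrable_of_abs_le (hgm.comp (H k).meas) fun x => hC _)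
      ((hFi k n).sub (hhi k)).abs hL (fun x => hgL _ _) (hest k n hn).2
    have h3 := abs_sub_le (∫ x, g (a k * normalizedAvg d μ n f x) ∂μ) (∫ x, g (h k x) ∂μ)
      (∫ t, g t ∂(ν k))
    have h4 := hK k hk
    have h5 := mul_le_mul_of_nonneg_left (hεε' k) hL
    linarith
  · intro g η hη
    obtain ⟨C, hC0, hC⟩ := g.exists_abs_le
    obtain ⟨L, hL, hgL⟩ := g.exists_lipschitz_up_to (show 0 < η / 8 by positivity)
    have hgm : Measurable g := (map_continuous g).measurable
    obtain ⟨K, hK⟩ := hsmall (24 * L + C) (η / 2) (by positivity)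
    -- The later scale is written `i + 1` and the error is controlled by `ε' i`, hence the shift by
    -- one.
    refine ⟨K + 1, fun k j hkj hmax n hn m hm => ?_⟩
    rw [integral_valueDistribution ((hFm k n).prodMk (hFm j m)) hgm,
      integral_prod_valueDistribution (hFm k n) (hFm j m) hgm]
    rcases lt_or_gt_of_ne hkj with hlt | hlt
    · obtain ⟨i, rfl⟩ : ∃ i, j = i + 1 := ⟨j - 1, by omega⟩
      -- The estimate has the later scale in the first coordinate, so here the two coordinates are
      -- exchanged.
      have h1 := hpair (fun p => g p.swap) (hgm.comp measurable_swap) C (η / 8) L hL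
        (fun t => hC _) (fun s t => by
          have := hgL s.swap t.swap
          rwa [show dist s.swap t.swap = dist s t by
            simp only [Prod.dist_eq, Prod.fst_swap, Prod.snd_swap]
            exact max_comm _ _] at this)
        i k (by omega) m hm n hn
      have h2 := integral_prod_swap (μ := μ) (ν := μ) fun p : X × X =>
        g (a k * normalizedAvg d μ n f p.1, a (i + 1) * normalizedAvg d μ m f p.2)
      simp only [Prod.swap_prod_mk, Prod.fst_swap, Prod.snd_swap] at h1 h2
      rw [h2] at h1
      have h3 := hK i (by omega)
      linarith
    · obtain ⟨i, rfl⟩ : ∃ i, k = i + 1 := ⟨k - 1, by omega⟩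
      have h1 := hpair g hgm C (η / 8) L hL hC hgL i j (by omega) n hn m hm
      have h3 := hK i (by omega)
      linarith
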